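/- Let $n\ge 0$ and let $\gamma\in PSL(n+1,\mathbb{C})$ act on the complex projective space $\mathbb{P}^n=\mathbb{P}(\mathbb{C}^{n+1})$ with the Fubini–Study metric. Call $\gamma$ *elliptic* if each lift $\widetilde\gamma\in SL(n+1,\mathbb{C})$ is diagonalizable and all its eigenvalues have modulus $1$; *loxodromic* if each lift in $SL(n+1,\mathbb{C})$ has an eigenvalue of modulus different from $1$; and *parabolic* if each lift in $SL(n+1,\mathbb{C})$ has only eigenvalues of modulus $1$ and is not diagonalizable. The equicontinuity set $Eq(\langle\gamma\rangle)$ is the set of points $z\in\mathbb{P}^n$ that have an open neighborhood $U$ on which the family $\{\gamma^k : k\in\mathbb{Z}\}$ is normal, i.e. every sequence in the family has a subsequence converging uniformly on the compact subsets of $U$. A projective subspace of $\mathbb{P}^n$ is a non-empty set of the form $[W\setminus\{0\}]$ with $W$ a linear subspace of $\mathbb{C}^{n+1}$. Then: 1. $\gamma$ is elliptic if and only if $Eq(\langle\gamma\rangle)=\mathbb{P}^n$. 2. $\gamma$ is loxodromic if and only if there are two proper projective subspaces $\mathcal{L}_1,\mathcal{L}_2$ of $\mathbb{P}^n$, neither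 of which is contained in the other, such that $Eq(\langle\gamma\rangle)=\mathbb{P}^n\setminus(\mathcal{L}_1\cup\mathcal{L}_2)$. 3. $\gamma$ is parabolic if and only if there is a projective subspace $\mathcal{L}_1$ of $\mathbb{P}^n$ such that $Eq(\langle\gamma\rangle)=\mathbb{P}^n\setminus\mathcal{L}_1$; in this case $\mathcal{L}_1$ is proper, i.e. $Eq(\langle\gamma\rangle)\neq\emptyset$. -/

import Mathlib

open scoped LinearAlgebra.Projectivization MatrixGroups

/-! ### The Fubini–Study metric on complex projective space -/

/-- The Fubini–Study angle `arccos (|⟨u, v⟩| / (‖u‖ ‖v‖))` of two vectors of `ℂ^m`, for the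
standard Hermitian inner product. -/
noncomputable def fsAngle {m : ℕ} (u v : Fin m → ℂ) : ℝ :=
  Real.arccos (‖inner ℂ (WithLp.toLp 2 u : EuclideanSpace ℂ (Fin m)) (WithLp.toLp 2 v)‖ /
    (‖(WithLp.toLp 2 u : EuclideanSpace ℂ (Fin m))‖ *
      ‖(WithLp.toLp 2 v : EuclideanSpace ℂ (Fin m))‖))

theorem fsAngle_comm {m : ℕ} (u v : Fin m → ℂ) : fsAngle u v = fsAngle v u := by
  unfold fsAngle
  rw [norm_inner_symm, mul_comm]

theorem fsAngle_smul_right {m : ℕ} (u v : Fin m → ℂ) {c : ℂ} (hc : c ≠ 0) :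
    fsAngle u (c • v) = fsAngle u v := by
  have hc' : ‖c‖ ≠ 0 := norm_ne_zero_iff.mpr hc
  unfold fsAngle
  rw [WithLp.toLp_smul, inner_smul_right, norm_mul, norm_smul, mul_left_comm,
    mul_div_mul_left _ _ hc']

theorem fsAngle_smul_left {m : ℕ} (u v : Fin m → ℂ) {c : ℂ} (hc : c ≠ 0) :
    fsAngle (c • u) v = fsAngle u v := by
  rw [fsAngle_comm, fsAngle_smul_right _ _ hc, fsAngle_comm]

theorem fsAngle_self {m : ℕ} {u : Fin m → ℂ} (hu : u ≠ 0) : fsAngle u u = 0 := by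
  have h : ‖(WithLp.toLp 2 u : EuclideanSpace ℂ (Fin m))‖ ≠ 0 := by simpa using hu
  unfold fsAngle
  rw [inner_self_eq_norm_sq_to_K, Real.arccos_eq_zero]
  simp [sq, h]

theorem exists_smul_eq_of_fsAngle_eq_zero {m : ℕ} {u v : Fin m → ℂ} (hu : u ≠ 0) (hv : v ≠ 0)
    (h : fsAngle u v = 0) : ∃ c : ℂ, c • u = v := by
  have hu' : (WithLp.toLp 2 u : EuclideanSpace ℂ (Fin m)) ≠ 0 := by simpa using hu
  have hv' : (WithLp.toLp 2 v : EuclideanSpace ℂ (Fin m)) ≠ 0 := by simpa using hv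
  have hpos := mul_pos (norm_pos_iff.mpr hu') (norm_pos_iff.mpr hv')
  unfold fsAngle at h
  rw [Real.arccos_eq_zero, one_le_div hpos] at h
  obtain ⟨c, -, hc⟩ := (norm_inner_eq_norm_iff (𝕜 := ℂ) hu' hv').mp
    (le_antisymm (norm_inner_le_norm _ _) h)
  exact ⟨c, (by simpa using congrArg WithLp.ofLp hc.symm)⟩

theorem fsAngle_triangle {m : ℕ} (u v w : Fin m → ℂ) :
    fsAngle u w ≤ fsAngle u v + fsAngle v w := by
  have phase : ∀ z : ℂ, ∃ c : ℂ, c ≠ 0 ∧ c * z = (‖z‖ : ℂ) := by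
    intro z
    by_cases hz : z = 0
    · exact ⟨1, one_ne_zero, by simp [hz]⟩
    · exact ⟨‖z‖ / z, div_ne_zero (by simpa using hz) hz, div_mul_cancel₀ _ hz⟩
  let _ : InnerProductSpace ℝ (EuclideanSpace ℂ (Fin m)) :=
    InnerProductSpace.rclikeToReal ℂ (EuclideanSpace ℂ (Fin m))
  have key : ∀ x y : Fin m → ℂ, fsAngle x y ≤ InnerProductGeometry.angle
      (WithLp.toLp 2 x : EuclideanSpace ℂ (Fin m)) (WithLp.toLp 2 y) := by
    intro x y
    unfold fsAngle InnerProductGeometry.angle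
    apply Real.arccos_le_arccos
    gcongr
    exact (Complex.re_le_norm _)
  have keyEq : ∀ x y : Fin m → ℂ, ∃ c : ℂ, c ≠ 0 ∧ fsAngle x (c • y) =
      InnerProductGeometry.angle
        (WithLp.toLp 2 x : EuclideanSpace ℂ (Fin m)) (WithLp.toLp 2 (c • y)) := by
    intro x y
    obtain ⟨c, hc, h⟩ := phase
      (inner ℂ (WithLp.toLp 2 x : EuclideanSpace ℂ (Fin m)) (WithLp.toLp 2 y))
    refine ⟨c, hc, ?_⟩
    have h1 : inner ℂ (WithLp.toLp 2 x : EuclideanSpace ℂ (Fin m)) (WithLp.toLp 2 (c • y)) =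
        (‖inner ℂ (WithLp.toLp 2 x : EuclideanSpace ℂ (Fin m)) (WithLp.toLp 2 y)‖ : ℂ) := by
      rw [WithLp.toLp_smul, inner_smul_right, h]
    have h2 : inner ℝ (WithLp.toLp 2 x : EuclideanSpace ℂ (Fin m)) (WithLp.toLp 2 (c • y)) =
        ‖inner ℂ (WithLp.toLp 2 x : EuclideanSpace ℂ (Fin m)) (WithLp.toLp 2 (c • y))‖ := by
      change (inner ℂ (WithLp.toLp 2 x : EuclideanSpace ℂ (Fin m))
        (WithLp.toLp 2 (c • y))).re = _
      rw [h1]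
      simp
    unfold fsAngle InnerProductGeometry.angle
    rw [h2]
  obtain ⟨c, hc, h1⟩ := keyEq u v
  obtain ⟨d, hd, h2⟩ := keyEq (c • v) w
  rw [← fsAngle_smul_right u w hd, ← fsAngle_smul_right u v hc, ← fsAngle_smul_left v w hc,
    ← fsAngle_smul_right (c • v) w hd, h1, h2]
  exact (key _ _).trans (InnerProductGeometry.angle_le_angle_add_angle _ _ _)

/-- Complex projective space with the Fubini–Study metric
`d([u], [v]) = arccos (|⟨u, v⟩| / (‖u‖ ‖v‖))`; it induces the usual topology. -/
noncomputable instance fubiniStudyMetricSpace {m : ℕ} : MetricSpace (ℙ ℂ (Fin m → ℂ)) where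
  dist p q := fsAngle p.rep q.rep
  dist_self p := fsAngle_self p.rep_nonzero
  dist_comm _ _ := fsAngle_comm _ _
  dist_triangle _ _ _ := fsAngle_triangle _ _ _
  eq_of_dist_eq_zero {p q} h := by
    rw [← p.mk_rep, ← q.mk_rep, eq_comm, Projectivization.mk_eq_mk_iff']
    exact exists_smul_eq_of_fsAngle_eq_zero p.rep_nonzero q.rep_nonzero h

/-- The Fubini–Study distance does not depend on the representatives. -/
theorem dist_mk_mk {m : ℕ} (u v : Fin m → ℂ) (hu : u ≠ 0) (hv : v ≠ 0) :
    dist (Projectivization.mk ℂ u hu) (Projectivization.mk ℂ v hv) = fsAngle u v := by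
  obtain ⟨a, ha⟩ := Projectivization.exists_smul_eq_mk_rep ℂ u hu
  obtain ⟨b, hb⟩ := Projectivization.exists_smul_eq_mk_rep ℂ v hv
  change fsAngle (Projectivization.mk ℂ u hu).rep (Projectivization.mk ℂ v hv).rep = _
  rw [← ha, ← hb, Units.smul_def, Units.smul_def, fsAngle_smul_left _ _ a.ne_zero,
    fsAngle_smul_right _ _ b.ne_zero]

/-! ### Normal families and the equicontinuity region -/

/-- A family `F` of self-maps of a metric space `X` is normal on `U` if every sequence in `F` has a
subsequence that converges, uniformly on the compact subsets of `U`, to some map. -/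
def IsNormalFamilyOn {X : Type*} [MetricSpace X] (F : Set (X → X)) (U : Set X) : Prop :=
  ∀ g : ℕ → X → X, (∀ j, g j ∈ F) →
    ∃ φ : ℕ → ℕ, StrictMono φ ∧ ∃ f : X → X,
      ∀ K : Set X, K ⊆ U → IsCompact K →
        TendstoUniformlyOn (fun j => g (φ j)) f Filter.atTop K

/-- The equicontinuity region of a family `F` of self-maps: the points that have an open
neighborhood on which `F` is normal. -/
def equicontinuityRegion {X : Type*} [MetricSpace X] (F : Set (X → X)) : Set X :=
  {z | ∃ U : Set X, IsOpen U ∧ z ∈ U ∧ IsNormalFamilyOn F U}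

/-- `Eq(Γ)` for a subgroup `Γ` of `PSL(n+1, ℂ)`, acting on `ℙⁿ` by projective transformations. -/
def projEquicontinuitySet {n : ℕ} (Γ : Subgroup PSL(n + 1, ℂ)) : Set (ℙ ℂ (Fin (n + 1) → ℂ)) :=
  equicontinuityRegion {g | ∃ γ ∈ Γ, g = fun p => γ • p}

/-! ### Elliptic, loxodromic and parabolic projective transformations -/

/-- The square matrix `A` is similar to a diagonal matrix. -/
def IsDiagonalizableMatrix {m : ℕ} (A : Matrix (Fin m) (Fin m) ℂ) : Prop :=
  ∃ P : GL (Fin m) ℂ,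
    ((P⁻¹ : GL (Fin m) ℂ).val * A * P.val).IsDiag

/-- Every eigenvalue of `A` has modulus `1`. -/
def HasUnitaryEigenvalues {m : ℕ} (A : Matrix (Fin m) (Fin m) ℂ) : Prop :=
  ∀ μ : ℂ, Module.End.HasEigenvalue (Matrix.toLin' A) μ → ‖μ‖ = 1

/-- Every lift to `SL(n+1, ℂ)` is diagonalizable with unitary eigenvalues. -/
def IsEllipticPSL {n : ℕ} (γ : PSL(n + 1, ℂ)) : Prop :=
  ∀ A : SL(n + 1, ℂ), (QuotientGroup.mk A : PSL(n + 1, ℂ)) = γ →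
    IsDiagonalizableMatrix A.val ∧ HasUnitaryEigenvalues A.val

/-- Every lift to `SL(n+1, ℂ)` has a non-unitary eigenvalue. -/
def IsLoxodromicPSL {n : ℕ} (γ : PSL(n + 1, ℂ)) : Prop :=
  ∀ A : SL(n + 1, ℂ), (QuotientGroup.mk A : PSL(n + 1, ℂ)) = γ →
    ∃ μ : ℂ, Module.End.HasEigenvalue (Matrix.toLin' A.val) μ ∧ ‖μ‖ ≠ 1

/-- Every lift to `SL(n+1, ℂ)` has only unitary eigenvalues and is not diagonalizable. -/
def IsParabolicPSL {n : ℕ} (γ : PSL(n + 1, ℂ)) : Prop :=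
  ∀ A : SL(n + 1, ℂ), (QuotientGroup.mk A : PSL(n + 1, ℂ)) = γ →
    HasUnitaryEigenvalues A.val ∧ ¬ IsDiagonalizableMatrix A.val

/-- `H ⊆ ℙⁿ` is a projective subspace: a non-empty set of the form `[W ∖ {0}]` for a linear
subspace `W` of `ℂ^{n+1}`. -/
def IsProjectiveSubspace {n : ℕ} (H : Set (ℙ ℂ (Fin (n + 1) → ℂ))) : Prop :=
  H.Nonempty ∧ ∃ W : Submodule ℂ (Fin (n + 1) → ℂ), H = (W.projectivization : Set _)

/-! Lift `γ` to a matrix `A`, with operator `f` and inverse `g`. By Jordan theory every nonzero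
orbit `f ^ k v` grows like `‖μ‖ ^ k * k ^ m`, and these rates are totally ordered, so some orbit is
dominant and the vectors growing strictly slower form a proper subspace: `subdominantSubmodule`.

The key is `projEquicontinuitySet_zpowers_eq`: `Eq` is the complement of the two subspaces attached
to `f` and `g`. If `v` is subdominant, a tiny multiple of a dominant vector added to `v` takes over
under a high power, so nearby points are driven apart. If `v` is subdominant for neither, the
operators `A ^ k / ‖A ^ k v‖` are bounded, and compactness gives limits that do not vanish near `v`.

It remains to compare the two subspaces. For unit eigenvalues they coincide, and they are zero
exactly when `A` is diagonalizable. Otherwise `det A = 1` forces two distinct moduli; each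
generalized eigenspace then lies in one of the two proper subspaces, so neither contains the other.
The three resulting shapes of `Eq` exclude each other, which gives the converses. -/

open Asymptotics Filter Module.End

/-! ### Growth rates of orbits of an invertible operator. -/

section LinearDynamics

variable {E : Type*} [NormedAddCommGroup E] [NormedSpace ℂ E]

/-- From `g - μ⁻¹ = -μ⁻¹ g (f - μ)`. Hence a vector has the same nilpotency index for `f` at `μ` as
for `g` at `μ⁻¹`, so both orbits carry the same power of `k`. -/
theorem sub_algebraMap_pow_of_mul_eq_one {f g : Module.End ℂ E} (hfg : f * g = 1) (hgf : g * f = 1)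
    {μ : ℂ} (hμ : μ ≠ 0) (m : ℕ) :
    (g - algebraMap ℂ _ μ⁻¹) ^ m = (-μ⁻¹) ^ m • (g ^ m * (f - algebraMap ℂ _ μ) ^ m) := by
  have h : g - algebraMap ℂ _ μ⁻¹ = (-μ⁻¹) • (g * (f - algebraMap ℂ _ μ)) := by
    rw [mul_sub, hgf, ← Algebra.commutes, ← Algebra.smul_def, smul_sub, smul_smul,
      Algebra.algebraMap_eq_smul_one]
    simp [hμ, sub_eq_neg_add, add_comm]
  have hc : Commute g (f - algebraMap ℂ _ μ) := by
    refine Commute.sub_right ?_ (Algebra.commutes _ _).symm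
    rw [Commute, SemiconjBy, hfg, hgf]
  rw [h, smul_pow, hc.mul_pow]

theorem isTheta_sum_choose_smul {m : ℕ} {x : ℕ → E} (hx : x m ≠ 0) :
    (fun k : ℕ => ∑ i ∈ Finset.range (m + 1), (k.choose i : ℂ) • x i) =Θ[atTop]
      fun k : ℕ => (k : ℝ) ^ m := by
  have hch (i : ℕ) : (fun k : ℕ => (k.choose i : ℂ)) =Θ[atTop] fun k : ℕ => (k : ℝ) ^ i := by
    refine IsTheta.trans (g := fun k : ℕ => (k.choose i : ℝ)) ?_ (isTheta_choose i)
    exact IsTheta.of_norm_eventuallyEq_norm (by simp [EventuallyEq.refl])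
  simp_rw [Finset.sum_range_succ, add_comm (∑ i ∈ Finset.range m, _)]
  have hm : (fun k : ℕ => (k.choose m : ℂ) • x m) =Θ[atTop] fun k : ℕ => (k : ℝ) ^ m := by
    have := (hch m).smul (isTheta_const_const hx (one_ne_zero (α := ℝ)) (l := atTop))
    simpa using this
  have hlow : (fun k : ℕ => ∑ i ∈ Finset.range m, (k.choose i : ℂ) • x i) =o[atTop]
      fun k : ℕ => (k : ℝ) ^ m := by
    refine IsLittleO.fun_sum fun i hi => ?_
    have h1 : (fun k : ℕ => (k.choose i : ℂ) • x i) =O[atTop] fun k : ℕ => (k : ℝ) ^ i := by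
      have := (hch i).1.smul (isBigO_const_const (x i) (one_ne_zero (α := ℝ)) atTop)
      simpa using this
    exact h1.trans_isLittleO
      ((isLittleO_pow_pow_atTop_of_lt (Finset.mem_range.1 hi)).comp_tendsto
        tendsto_natCast_atTop_atTop)
  exact IsTheta.add_isLittleO hm hlow

/-- With `N = f - μ`, the binomial expansion of `(N + μ) ^ k v` stops at `i = m`, and its last term,
of order `k ^ m`, dominates. -/
theorem isTheta_pow_apply_of_sub_pow {f : Module.End ℂ E} {μ : ℂ} (hμ : μ ≠ 0) {m : ℕ} {v : E}
    (h : ((f - algebraMap ℂ _ μ) ^ m) v ≠ 0) (h' : ((f - algebraMap ℂ _ μ) ^ (m + 1)) v = 0) :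
    (fun k : ℕ => (f ^ k) v) =Θ[atTop] fun k : ℕ => ‖μ‖ ^ k * (k : ℝ) ^ m := by
  set N := f - algebraMap ℂ (Module.End ℂ E) μ with hN
  have hf : f = N + algebraMap ℂ _ μ := by simp [hN]
  have hzero : ∀ i, m < i → (N ^ i) v = 0 := by
    intro i hi
    obtain ⟨j, rfl⟩ := Nat.exists_eq_add_of_lt hi
    rw [show m + j + 1 = j + (m + 1) by ring, pow_add, Module.End.mul_apply, h', map_zero]
  have key : (fun k : ℕ => (f ^ k) v) =ᶠ[atTop] fun k : ℕ =>
      μ ^ k • ∑ i ∈ Finset.range (m + 1), (k.choose i : ℂ) • (μ⁻¹ ^ i • (N ^ i) v) := by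
    filter_upwards [eventually_ge_atTop m] with k hk
    rw [hf, Commute.add_pow (Algebra.commutes μ N).symm, LinearMap.sum_apply, Finset.smul_sum]
    symm
    refine Finset.sum_subset_zero_on_sdiff (by simpa using hk) ?_ ?_
    · intro i hi
      have : m < i := by simp at hi; omega
      rw [← map_pow, mul_assoc, ← Nat.cast_comm, ← mul_assoc, ← Nat.cast_comm, mul_assoc,
        ← Algebra.commutes]
      simp [hzero i this]
    · intro i hi
      have hik : i ≤ k := by simp at hi; omega
      have : ((k.choose i : ℕ) : Module.End ℂ E) = algebraMap ℂ _ (k.choose i : ℂ) := by simp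
      rw [this, ← map_pow, mul_assoc, ← map_mul, ← Algebra.commutes, ← Algebra.smul_def,
        LinearMap.smul_apply, smul_smul, smul_smul]
      congr 1
      rw [pow_sub₀ _ hμ hik, inv_pow]
      ring
  refine key.isTheta.trans ?_
  have hsum : (μ⁻¹ ^ m • (N ^ m) v) ≠ 0 := by simpa [hμ] using h
  refine IsTheta.smul (𝕜 := ℂ) (𝕜' := ℝ) ?_
    (isTheta_sum_choose_smul (x := fun i => μ⁻¹ ^ i • (N ^ i) v) hsum)
  exact IsTheta.of_norm_eventuallyEq_norm (by simp [EventuallyEq.refl])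

theorem pow_apply_pow_apply_of_mul_eq_one {f g : Module.End ℂ E} (hgf : g * f = 1) (k : ℕ) (v : E) :
    (g ^ k) ((f ^ k) v) = v := by
  rw [← Module.End.mul_apply, pow_mul_pow_eq_one k hgf, Module.End.one_apply]

theorem pow_apply_ne_zero {f g : Module.End ℂ E} (hgf : g * f = 1) (k : ℕ) {v : E} (hv : v ≠ 0) :
    (f ^ k) v ≠ 0 := fun h => hv (by rw [← pow_apply_pow_apply_of_mul_eq_one hgf k v, h, map_zero])

theorem exists_sub_pow_apply_ne_zero {f g : Module.End ℂ E} (hgf : g * f = 1) {μ : ℂ} {v : E}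
    (hv : v ≠ 0) (hvμ : v ∈ f.maxGenEigenspace μ) : ∃ m : ℕ, μ ≠ 0 ∧
      ((f - algebraMap ℂ _ μ) ^ m) v ≠ 0 ∧ ((f - algebraMap ℂ _ μ) ^ (m + 1)) v = 0 := by
  classical
  rw [mem_maxGenEigenspace] at hvμ
  have hμ : μ ≠ 0 := by
    rintro rfl
    obtain ⟨k, hk⟩ := hvμ
    exact pow_apply_ne_zero hgf k hv (by simpa using hk)
  rw [← Algebra.algebraMap_eq_smul_one] at hvμ
  obtain ⟨m, hm⟩ : ∃ m, Nat.find hvμ = m + 1 := by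
    refine Nat.exists_eq_succ_of_ne_zero fun h0 => hv ?_
    have := Nat.find_spec hvμ
    rwa [h0] at this
  refine ⟨m, hμ, Nat.find_min hvμ (by omega), ?_⟩
  have := Nat.find_spec hvμ
  rwa [hm] at this

theorem exists_isTheta_of_mem_maxGenEigenspace {f g : Module.End ℂ E} (hfg : f * g = 1)
    (hgf : g * f = 1) {μ : ℂ} {v : E} (hv : v ≠ 0) (hvμ : v ∈ f.maxGenEigenspace μ) :
    ∃ m : ℕ, (fun k : ℕ => (f ^ k) v) =Θ[atTop] (fun k : ℕ => ‖μ‖ ^ k * (k : ℝ) ^ m) ∧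
      (fun k : ℕ => (g ^ k) v) =Θ[atTop] (fun k : ℕ => ‖μ⁻¹‖ ^ k * (k : ℝ) ^ m) := by
  obtain ⟨m, hμ, h2, h1⟩ := exists_sub_pow_apply_ne_zero hgf hv hvμ
  refine ⟨m, isTheta_pow_apply_of_sub_pow hμ h2 h1,
    isTheta_pow_apply_of_sub_pow (inv_ne_zero hμ) ?_ ?_⟩
  · rw [sub_algebraMap_pow_of_mul_eq_one hfg hgf hμ]
    simpa [hμ] using pow_apply_ne_zero hfg m h2
  · rw [sub_algebraMap_pow_of_mul_eq_one hfg hgf hμ]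
    simp only [LinearMap.smul_apply, Module.End.mul_apply, h1, map_zero, smul_zero]

/-- The spectral projections of `f`. Commutation with the whole commutant of `f` lets the same
projections split the orbits of `g`. -/
theorem exists_maxGenEigenspace_projections [FiniteDimensional ℂ E] (f : Module.End ℂ E) :
    ∃ (s : Finset ℂ) (P : ℂ → Module.End ℂ E), (∀ v, ∑ μ ∈ s, P μ v = v) ∧
      (∀ μ v, P μ v ∈ f.maxGenEigenspace μ) ∧
      ∀ (h : Module.End ℂ E), Commute f h → ∀ μ v, P μ (h v) = h (P μ v) := by
  classical
  have hds := DirectSum.isInternal_submodule_of_iSupIndep_of_iSup_eq_top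
    f.independent_maxGenEigenspace f.iSup_maxGenEigenspace_eq_top
  have hfin : {μ | f.maxGenEigenspace μ ≠ ⊥}.Finite :=
    WellFoundedGT.finite_ne_bot_of_iSupIndep f.independent_maxGenEigenspace
  let _ := hds.chooseDecomposition
  let P : ℂ → Module.End ℂ E := fun μ => (f.maxGenEigenspace μ).subtype ∘ₗ
    DFinsupp.lapply μ ∘ₗ (DirectSum.decomposeLinearEquiv f.maxGenEigenspace).toLinearMap
  have hP (μ : ℂ) (v : E) : P μ v = DirectSum.decompose f.maxGenEigenspace v μ := rfl
  have hmem (μ : ℂ) (v : E) : P μ v ∈ f.maxGenEigenspace μ := by rw [hP]; exact Subtype.prop _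
  have hsum (v : E) : ∑ μ ∈ hfin.toFinset, P μ v = v := by
    conv_rhs => rw [← DirectSum.sum_support_decompose f.maxGenEigenspace v]
    symm
    refine Finset.sum_subset ?_ ?_
    · intro μ hμ
      simp only [Set.Finite.mem_toFinset, Set.mem_ofPred_eq]
      intro hbot
      rw [DFinsupp.mem_support_iff] at hμ
      refine hμ (Subtype.ext ?_)
      have h0 := hmem μ v
      rw [hbot, Submodule.mem_bot, hP] at h0
      simpa using h0
    · intro μ _ hμ
      simpa using hμ
  refine ⟨hfin.toFinset, P, hsum, hmem, fun h hc μ v => ?_⟩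
  have hmaps (ν : ℂ) : h (P ν v) ∈ f.maxGenEigenspace ν :=
    f.mapsTo_maxGenEigenspace_of_comm hc ν (hmem ν v)
  conv_lhs => rw [← hsum v, map_sum, map_sum]
  have hne (ν : ℂ) (hν : ν ≠ μ) : P μ (h (P ν v)) = 0 := by
    rw [hP μ]; exact DirectSum.decompose_of_mem_ne _ (hmaps ν) hν
  have hsame : P μ (h (P μ v)) = h (P μ v) := by
    rw [hP μ]; exact DirectSum.decompose_of_mem_same _ (hmaps μ)
  rw [Finset.sum_eq_single μ (fun ν _ => hne ν), hsame]
  intro hμ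
  have hbot : f.maxGenEigenspace μ = ⊥ := by simpa using hμ
  have h0 := hmem μ v
  rw [hbot, Submodule.mem_bot] at h0
  simp [h0]

/-- One bound is the triangle inequality; the other holds because each `P μ` is bounded and commutes
with `h ^ k`. No cancellation between components can occur. -/
theorem isTheta_sum_norm_projections [FiniteDimensional ℂ E] {s : Finset ℂ}
    {P : ℂ → Module.End ℂ E} (hsum : ∀ v, ∑ μ ∈ s, P μ v = v) {h : Module.End ℂ E}
    (hP : ∀ μ v, P μ (h v) = h (P μ v)) (v : E) :
    (fun k : ℕ => (h ^ k) v) =Θ[atTop] fun k : ℕ => ∑ μ ∈ s, ‖(h ^ k) (P μ v)‖ := by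
  have hPk (μ : ℂ) (k : ℕ) : (h ^ k) (P μ v) = P μ ((h ^ k) v) := by
    induction k with
    | zero => rfl
    | succ k ih => rw [pow_succ', Module.End.mul_apply, ih, Module.End.mul_apply, hP]
  constructor
  · refine IsBigO.of_norm_le fun k => ?_
    conv_lhs => rw [← hsum v, map_sum]
    exact norm_sum_le _ _
  · refine IsBigO.fun_sum fun μ _ => IsBigO.norm_left ?_
    refine IsBigO.of_bound ‖LinearMap.toContinuousLinearMap (P μ)‖ (Eventually.of_forall fun k => ?_)
    rw [hPk]
    exact (LinearMap.toContinuousLinearMap (P μ)).le_opNorm _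

/-- Rates compare lexicographically: by `r`, then by the exponent of `k`. -/
theorem isLittleO_or_isBigO_pow_mul_pow {r r' : ℝ} (hr : 0 < r) (hr' : 0 < r') (m m' : ℕ) :
    (fun k : ℕ => r ^ k * (k : ℝ) ^ m) =o[atTop] (fun k : ℕ => r' ^ k * (k : ℝ) ^ m') ∨
      (fun k : ℕ => r' ^ k * (k : ℝ) ^ m') =O[atTop] (fun k : ℕ => r ^ k * (k : ℝ) ^ m) := by
  have key {a b : ℝ} (ha : 0 < a) (hab : a < b) (p q : ℕ) :
      (fun k : ℕ => a ^ k * (k : ℝ) ^ p) =o[atTop] (fun k : ℕ => b ^ k * (k : ℝ) ^ q) := by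
    have h1 := isLittleO_pow_const_mul_const_pow_const_pow_of_norm_lt (R := ℝ) p
      (r₁ := a) (r₂ := b) (by rwa [Real.norm_of_nonneg ha.le])
    simp_rw [mul_comm ((_ : ℝ) ^ p)] at h1
    refine h1.trans_isBigO (IsBigO.of_bound 1 ?_)
    filter_upwards [eventually_ge_atTop 1] with k hk
    have hk' : (1 : ℝ) ≤ k := by exact_mod_cast hk
    have hb : 0 < b := ha.trans hab
    rw [one_mul, norm_mul]
    refine le_mul_of_one_le_right (norm_nonneg _) ?_
    rw [Real.norm_of_nonneg (by positivity)]
    exact one_le_pow₀ hk'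
  rcases lt_trichotomy r r' with h | rfl | h
  · exact Or.inl (key hr h m m')
  · rcases lt_or_ge m m' with hm | hm
    · left
      exact (isBigO_refl (fun k : ℕ => r ^ k) atTop).mul_isLittleO
        ((isLittleO_pow_pow_atTop_of_lt hm).comp_tendsto tendsto_natCast_atTop_atTop)
    · right
      refine (isBigO_refl (fun k : ℕ => r ^ k) atTop).mul ?_
      refine IsBigO.of_norm_eventuallyLE ?_
      filter_upwards [eventually_ge_atTop 1] with k hk
      rw [norm_pow, RCLike.norm_natCast]
      exact (pow_le_pow_right₀ (by exact_mod_cast hk) hm)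
  · exact Or.inr (key hr' h m' m).isBigO

theorem Finset.exists_forall_rel_of_total {ι : Type*} {r : ι → ι → Prop} {s : Finset ι}
    (htrans : ∀ i j k, r i j → r j k → r i k) (htot : ∀ i ∈ s, ∀ j ∈ s, r i j ∨ r j i)
    (hs : s.Nonempty) : ∃ i ∈ s, ∀ j ∈ s, r j i := by
  induction hs using Finset.Nonempty.cons_induction with
  | singleton a => exact ⟨a, by simp, by simpa using htot a (by simp) a (by simp)⟩
  | cons a s ha hs ih =>
    obtain ⟨i, hi, hmax⟩ := ih fun i hi j hj =>
      htot i (Finset.mem_cons_of_mem hi) j (Finset.mem_cons_of_mem hj)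
    rcases htot a (by simp) i (Finset.mem_cons_of_mem hi) with h | h
    · exact ⟨i, Finset.mem_cons_of_mem hi, by simpa [h] using hmax⟩
    · refine ⟨a, by simp, fun j hj => ?_⟩
      rcases Finset.mem_cons.1 hj with rfl | hj
      · exact (htot j (by simp) j (by simp)).elim id id
      · exact htrans _ _ _ (hmax j hj) h

theorem hasEigenvalue_of_mem_maxGenEigenspace {f : Module.End ℂ E} {μ : ℂ} {v : E} (hv : v ≠ 0)
    (h : v ∈ f.maxGenEigenspace μ) : f.HasEigenvalue μ := by
  refine (hasUnifEigenvalue_iff_hasUnifEigenvalue_one (k := ⊤) (by simp)).1 fun hbot => hv ?_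
  exact (Submodule.mem_bot ℂ).1 (hbot ▸ h)

theorem eigenvalue_ne_zero_of_mul_eq_one {f g : Module.End ℂ E} (hgf : g * f = 1) {μ : ℂ}
    (h : f.HasEigenvalue μ) : μ ≠ 0 := by
  rintro rfl
  obtain ⟨v, hv⟩ := h.exists_hasEigenvector
  refine pow_apply_ne_zero hgf 1 hv.2 ?_
  simpa using hv.apply_eq_smul

theorem isTheta_pow_apply_of_hasEigenvector {f : Module.End ℂ E} {μ : ℂ} {v : E}
    (h : f.HasEigenvector μ v) : (fun k : ℕ => (f ^ k) v) =Θ[atTop] fun k : ℕ => ‖μ‖ ^ k := by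
  simp_rw [h.pow_apply]
  have := IsTheta.smul (𝕜 := ℂ) (𝕜' := ℝ) (l := atTop) (f₁ := fun k : ℕ => μ ^ k)
    (f₂ := fun k : ℕ => ‖μ‖ ^ k) (IsTheta.of_norm_eventuallyEq_norm (by simp [EventuallyEq.refl]))
    (isTheta_const_const h.2 (one_ne_zero (α := ℝ)))
  simpa using this

/-! ### Dominant orbits and the subspace of slower ones. -/

/-- The orbit of `w` grows at least as fast as every other orbit of `f`. -/
def IsDominant (f : Module.End ℂ E) (w : E) : Prop :=
  ∀ v, (fun k : ℕ => (f ^ k) v) =O[atTop] fun k : ℕ => (f ^ k) w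

/-- The vectors whose orbit under `f` grows more slowly than the orbit of `w`. -/
def subdominantSubmodule (f : Module.End ℂ E) (w : E) : Submodule ℂ E where
  carrier := {v | (fun k : ℕ => (f ^ k) v) =o[atTop] fun k : ℕ => (f ^ k) w}
  add_mem' {a b} ha hb := by
    simp only [Set.mem_ofPred_eq, map_add] at *
    exact ha.add hb
  zero_mem' := by simp
  smul_mem' c v hv := by
    simp only [Set.mem_ofPred_eq, map_smul] at *
    exact hv.const_smul_left c

theorem mem_subdominantSubmodule {f : Module.End ℂ E} {w v : E} :
    v ∈ subdominantSubmodule f w ↔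
      (fun k : ℕ => (f ^ k) v) =o[atTop] fun k : ℕ => (f ^ k) w := Iff.rfl

theorem IsDominant.ne_zero [Nontrivial E] {f g : Module.End ℂ E} (hgf : g * f = 1) {w : E}
    (hw : IsDominant f w) : w ≠ 0 := by
  rintro rfl
  obtain ⟨v, hv⟩ := exists_ne (0 : E)
  have h := hw v
  simp only [map_zero, isBigO_zero_right_iff] at h
  obtain ⟨k, hk⟩ := h.exists
  exact pow_apply_ne_zero hgf k hv hk

theorem subdominantSubmodule_ne_top [Nontrivial E] {f g : Module.End ℂ E} (hgf : g * f = 1)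
    {w : E} (hw : IsDominant f w) : subdominantSubmodule f w ≠ ⊤ := by
  intro h
  have hmem : w ∈ subdominantSubmodule f w := h ▸ Submodule.mem_top
  refine isLittleO_irrefl ?_ (mem_subdominantSubmodule.1 hmem)
  exact (Eventually.of_forall fun k => pow_apply_ne_zero hgf k (hw.ne_zero hgf)).frequently

/-- The exponential gap absorbs the polynomial factor: `‖μ‖ ^ k * k ^ m` is negligible against `‖ν‖
^ k`, the growth of an eigenvector, which `w` dominates. -/
theorem mem_subdominantSubmodule_of_norm_lt {f g : Module.End ℂ E} (hfg : f * g = 1)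
    (hgf : g * f = 1) {w : E} (hw : IsDominant f w) {μ ν : ℂ} (hν : f.HasEigenvalue ν)
    (hlt : ‖μ‖ < ‖ν‖) {v : E} (hv : v ∈ f.maxGenEigenspace μ) :
    v ∈ subdominantSubmodule f w := by
  by_cases hv0 : v = 0
  · exact hv0 ▸ Submodule.zero_mem _
  obtain ⟨m, hm, -⟩ := exists_isTheta_of_mem_maxGenEigenspace hfg hgf hv0 hv
  obtain ⟨u, hu⟩ := hν.exists_hasEigenvector
  refine IsLittleO.trans_isBigO ?_ (hw u)
  refine hm.trans_isLittleO (IsLittleO.trans_isTheta ?_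
    (isTheta_pow_apply_of_hasEigenvector hu).symm)
  simpa [mul_comm] using isLittleO_pow_const_mul_const_pow_const_pow_of_norm_lt (R := ℝ) m
    (r₁ := ‖μ‖) (r₂ := ‖ν‖) (by simpa using hlt)

theorem mem_subdominantSubmodule_inverse_of_norm_lt {f g : Module.End ℂ E} (hfg : f * g = 1)
    (hgf : g * f = 1) {w : E} (hw : IsDominant g w) {μ ν : ℂ} (hν : f.HasEigenvalue ν)
    (hlt : ‖ν‖ < ‖μ‖) {v : E} (hv : v ∈ f.maxGenEigenspace μ) :
    v ∈ subdominantSubmodule g w := by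
  by_cases hv0 : v = 0
  · exact hv0 ▸ Submodule.zero_mem _
  obtain ⟨m, -, hm⟩ := exists_isTheta_of_mem_maxGenEigenspace hfg hgf hv0 hv
  obtain ⟨u, hu⟩ := hν.exists_hasEigenvector
  have hν0 := eigenvalue_ne_zero_of_mul_eq_one hgf hν
  have hu' : g.HasEigenvector ν⁻¹ u := by
    refine ⟨mem_eigenspace_iff.2 ?_, hu.2⟩
    rw [← mul_one g, ← one_mul (g * 1), eq_inv_smul_iff₀ hν0, ← map_smul]
    have h1 := congrArg g hu.apply_eq_smul
    rw [← Module.End.mul_apply, hgf] at h1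
    simpa using h1.symm
  refine IsLittleO.trans_isBigO ?_ (hw u)
  refine hm.trans_isLittleO (IsLittleO.trans_isTheta ?_
    (isTheta_pow_apply_of_hasEigenvector hu').symm)
  have hlt' : ‖μ⁻¹‖ < ‖ν⁻¹‖ := by
    rw [norm_inv, norm_inv]
    exact inv_strictAnti₀ (norm_pos_iff.2 hν0) hlt
  simpa [mul_comm] using isLittleO_pow_const_mul_const_pow_const_pow_of_norm_lt (R := ℝ) m
    (r₁ := ‖μ⁻¹‖) (r₂ := ‖ν⁻¹‖) (by simpa using hlt')

section FiniteDimensional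

variable [FiniteDimensional ℂ E]

/-- The fastest nonzero spectral component of `v` sets the rate of its orbit. -/
theorem exists_eigenvalue_isTheta_pow_apply {f g : Module.End ℂ E} (hfg : f * g = 1)
    (hgf : g * f = 1) {v : E} (hv : v ≠ 0) : ∃ (μ : ℂ) (m : ℕ), f.HasEigenvalue μ ∧
      (fun k : ℕ => (f ^ k) v) =Θ[atTop] fun k : ℕ => ‖μ‖ ^ k * (k : ℝ) ^ m := by
  classical
  obtain ⟨s, P, hsum, hmem, hcomm⟩ := exists_maxGenEigenspace_projections f
  have hΘ := isTheta_sum_norm_projections hsum (fun μ v => hcomm f (Commute.refl f) μ v) v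
  -- The exponent is arbitrary where the component vanishes.
  have hex (μ : ℂ) : ∃ m : ℕ, P μ v ≠ 0 →
      (fun k : ℕ => (f ^ k) (P μ v)) =Θ[atTop] fun k : ℕ => ‖μ‖ ^ k * (k : ℝ) ^ m := by
    by_cases h : P μ v = 0
    · exact ⟨0, fun h' => absurd h h'⟩
    · obtain ⟨m, hm, -⟩ := exists_isTheta_of_mem_maxGenEigenspace hfg hgf h (hmem μ v)
      exact ⟨m, fun _ => hm⟩
  choose m hm using hex
  have hne : (s.filter fun μ => P μ v ≠ 0).Nonempty := by
    by_contra! hemp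
    refine hv ?_
    rw [← hsum v]
    refine Finset.sum_eq_zero fun μ hμ => ?_
    by_contra h0
    have : μ ∈ s.filter fun μ => P μ v ≠ 0 := by simp [hμ, h0]
    rw [hemp] at this
    simp at this
  have heig {μ : ℂ} (h : P μ v ≠ 0) : f.HasEigenvalue μ :=
    hasEigenvalue_of_mem_maxGenEigenspace h (hmem μ v)
  have hpos {μ : ℂ} (h : P μ v ≠ 0) : 0 < ‖μ‖ :=
    norm_pos_iff.2 (eigenvalue_ne_zero_of_mul_eq_one hgf (heig h))
  obtain ⟨μ, hμ, hmax⟩ := Finset.exists_forall_rel_of_total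
    (r := fun μ ν : ℂ => (fun k : ℕ => ‖μ‖ ^ k * (k : ℝ) ^ m μ) =O[atTop]
      fun k : ℕ => ‖ν‖ ^ k * (k : ℝ) ^ m ν) (fun _ _ _ => IsBigO.trans)
    (fun μ hμ ν hν => (isLittleO_or_isBigO_pow_mul_pow (hpos (Finset.mem_filter.1 hμ).2)
      (hpos (Finset.mem_filter.1 hν).2) _ _).imp_left IsLittleO.isBigO) hne
  rw [Finset.mem_filter] at hμ
  refine ⟨μ, m μ, heig hμ.2, hΘ.trans ⟨IsBigO.fun_sum fun ν hν => IsBigO.norm_left ?_, ?_⟩⟩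
  · by_cases h : P ν v = 0
    · simpa [h] using isBigO_zero _ _
    · exact (hm ν h).1.trans (hmax ν (Finset.mem_filter.2 ⟨hν, h⟩))
  · refine (hm μ hμ.2).2.trans (IsBigO.of_norm_le fun k => ?_)
    exact Finset.single_le_sum (f := fun ν => ‖(f ^ k) (P ν v)‖) (fun _ _ => norm_nonneg _) hμ.1

/-- With unit moduli only the factor `k ^ m` remains on each component, and it is the same for `f`
and `g`. -/
theorem isTheta_pow_apply_inverse {f g : Module.End ℂ E} (hfg : f * g = 1) (hgf : g * f = 1)
    (hunit : ∀ μ, f.HasEigenvalue μ → ‖μ‖ = 1) (v : E) :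
    (fun k : ℕ => (f ^ k) v) =Θ[atTop] fun k : ℕ => (g ^ k) v := by
  obtain ⟨s, P, hsum, hmem, hcomm⟩ := exists_maxGenEigenspace_projections f
  have hf := isTheta_sum_norm_projections hsum (fun μ v => hcomm f (Commute.refl f) μ v) v
  have hg := isTheta_sum_norm_projections hsum
    (fun μ v => hcomm g (by rw [Commute, SemiconjBy, hfg, hgf]) μ v) v
  have hcomp (μ : ℂ) : (fun k : ℕ => (f ^ k) (P μ v)) =Θ[atTop] fun k : ℕ => (g ^ k) (P μ v) := by
    by_cases h : P μ v = 0
    · simp only [h, map_zero]; exact isTheta_rfl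
    · obtain ⟨m, h1, h2⟩ := exists_isTheta_of_mem_maxGenEigenspace hfg hgf h (hmem μ v)
      have hμ := hunit μ (hasEigenvalue_of_mem_maxGenEigenspace h (hmem μ v))
      rw [norm_inv, hμ, inv_one] at h2
      rw [hμ] at h1
      exact h1.trans h2.symm
  have hle {a b : ℂ → ℕ → E} (h : ∀ μ, a μ =O[atTop] b μ) :
      (fun k => ∑ μ ∈ s, ‖a μ k‖) =O[atTop] fun k => ∑ μ ∈ s, ‖b μ k‖ := by
    refine IsBigO.fun_sum fun μ hμ => IsBigO.norm_left ((h μ).trans (IsBigO.of_norm_le fun k => ?_))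
    exact Finset.single_le_sum (f := fun ν => ‖b ν k‖) (fun _ _ => norm_nonneg _) hμ
  exact hf.trans (IsTheta.trans ⟨hle fun μ => (hcomp μ).1, hle fun μ => (hcomp μ).2⟩ hg.symm)

theorem isLittleO_or_isBigO_pow_apply {f g : Module.End ℂ E} (hfg : f * g = 1) (hgf : g * f = 1)
    (v w : E) : (fun k : ℕ => (f ^ k) v) =o[atTop] (fun k : ℕ => (f ^ k) w) ∨
      (fun k : ℕ => (f ^ k) w) =O[atTop] (fun k : ℕ => (f ^ k) v) := by
  by_cases hv : v = 0
  · left; simp [hv]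
  by_cases hw : w = 0
  · right; simpa [hw] using isBigO_zero _ _
  obtain ⟨μ, m, hμ, h1⟩ := exists_eigenvalue_isTheta_pow_apply hfg hgf hv
  obtain ⟨ν, p, hν, h2⟩ := exists_eigenvalue_isTheta_pow_apply hfg hgf hw
  refine (isLittleO_or_isBigO_pow_mul_pow
    (norm_pos_iff.2 (eigenvalue_ne_zero_of_mul_eq_one hgf hμ))
    (norm_pos_iff.2 (eigenvalue_ne_zero_of_mul_eq_one hgf hν)) m p).imp (fun h => ?_) fun h => ?_
  · exact (h1.trans_isLittleO h).trans_isTheta h2.symm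
  · exact (h2.1.trans h).trans h1.2

theorem exists_isDominant {f g : Module.End ℂ E} (hfg : f * g = 1) (hgf : g * f = 1) :
    ∃ w, IsDominant f w := by
  classical
  let b := Module.finBasis ℂ E
  -- Inserting `0` keeps the set nonempty when `E` is trivial.
  obtain ⟨w, -, hw⟩ := Finset.exists_forall_rel_of_total (s := insert 0 (Finset.univ.image b))
    (r := fun v w => (fun k : ℕ => (f ^ k) v) =O[atTop] fun k : ℕ => (f ^ k) w)
    (fun _ _ _ => IsBigO.trans)
    (fun v _ w _ => (isLittleO_or_isBigO_pow_apply hfg hgf v w).imp_left IsLittleO.isBigO)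
    (Finset.insert_nonempty _ _)
  refine ⟨w, fun v => ?_⟩
  rw [← b.sum_repr v]
  simp only [map_sum, map_smul]
  exact IsBigO.fun_sum fun i _ => (hw (b i) (by simp)).const_smul_left _

theorem subdominantSubmodule_eq_of_unit_eigenvalues {f g : Module.End ℂ E} (hfg : f * g = 1)
    (hgf : g * f = 1) (hunit : ∀ μ, f.HasEigenvalue μ → ‖μ‖ = 1) {w w' : E}
    (hw : IsDominant f w) (hw' : IsDominant g w') :
    subdominantSubmodule f w = subdominantSubmodule g w' := by
  have hΘ := isTheta_pow_apply_inverse hfg hgf hunit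
  have hww' : (fun k : ℕ => (f ^ k) w) =Θ[atTop] fun k : ℕ => (g ^ k) w' :=
    ⟨(hΘ w).1.trans (hw' w), (hΘ w').2.trans (hw w')⟩
  ext v
  rw [mem_subdominantSubmodule, mem_subdominantSubmodule, (hΘ v).isLittleO_congr_left,
    hww'.isLittleO_congr_right]

/-- All orbits are bounded, while a nonzero orbit stays bounded away from zero eventually; so no
nonzero orbit is negligible against another. -/
theorem subdominantSubmodule_eq_bot_of_iSup_eigenspace {f g : Module.End ℂ E} (hfg : f * g = 1)
    (hgf : g * f = 1) (hunit : ∀ μ, f.HasEigenvalue μ → ‖μ‖ = 1)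
    (htop : ⨆ μ, f.eigenspace μ = ⊤) (w : E) : subdominantSubmodule f w = ⊥ := by
  have hbdd (v : E) : (fun k : ℕ => (f ^ k) v) =O[atTop] fun _ => (1 : ℝ) := by
    have hv : v ∈ ⨆ μ, f.eigenspace μ := htop ▸ Submodule.mem_top
    induction hv using Submodule.iSup_induction' with
    | mem μ v hv =>
      by_cases h0 : v = 0
      · simp only [h0, map_zero]; exact isBigO_zero _ _
      · have h : f.HasEigenvector μ v := ⟨hv, h0⟩
        simpa [hunit μ (hasEigenvalue_of_hasEigenvector h)] using
          (isTheta_pow_apply_of_hasEigenvector h).1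
    | zero => simp only [map_zero]; exact isBigO_zero _ _
    | add v w _ _ hv hw => simpa only [map_add] using hv.add hw
  refine (Submodule.eq_bot_iff _).2 fun v hv => ?_
  by_contra hv0
  obtain ⟨μ, m, hμ, h⟩ := exists_eigenvalue_isTheta_pow_apply hfg hgf hv0
  have h1 : (fun _ : ℕ => (1 : ℝ)) =O[atTop] fun k : ℕ => (f ^ k) v := by
    refine IsBigO.trans (IsBigO.of_bound 1 ?_) h.2
    filter_upwards [eventually_ge_atTop 1] with k hk
    have hk' : (1 : ℝ) ≤ k := by exact_mod_cast hk
    simpa [hunit μ hμ] using one_le_pow₀ hk'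
  have h2 := (h1.trans_isLittleO (mem_subdominantSubmodule.1 hv)).trans_isBigO (hbdd w)
  exact isLittleO_irrefl (Eventually.of_forall fun _ => one_ne_zero).frequently h2

/-- A nontrivial Jordan chain starting at `v` ends in an eigenvector `u`, whose orbit lacks the
factor `k ^ m` of the orbit of `v`; so `u` would be a nonzero subdominant vector. -/
theorem iSup_eigenspace_eq_top_of_subdominantSubmodule_eq_bot {f g : Module.End ℂ E}
    (hgf : g * f = 1) {w : E} (hw : IsDominant f w)
    (hbot : subdominantSubmodule f w = ⊥) : ⨆ μ, f.eigenspace μ = ⊤ := by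
  rw [eq_top_iff, ← f.iSup_maxGenEigenspace_eq_top]
  refine iSup_mono fun μ v hv => ?_
  by_contra hv'
  have hv0 : v ≠ 0 := fun h => hv' (h ▸ Submodule.zero_mem _)
  obtain ⟨m, hμ, hm, hm'⟩ := exists_sub_pow_apply_ne_zero hgf hv0 hv
  have hmpos : 0 < m := by
    refine Nat.pos_of_ne_zero ?_
    rintro rfl
    refine hv' ?_
    rw [mem_eigenspace_iff]
    simpa [sub_eq_zero] using hm'
  set u := ((f - algebraMap ℂ _ μ) ^ m) v with hu
  have hu' : f.HasEigenvector μ u := by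
    refine ⟨mem_eigenspace_iff.2 ?_, hm⟩
    rw [pow_succ', Module.End.mul_apply, ← hu] at hm'
    simpa [sub_eq_zero] using hm'
  have hmem : u ∈ subdominantSubmodule f w := by
    refine IsLittleO.trans_isBigO ?_ (hw v)
    refine (isTheta_pow_apply_of_hasEigenvector hu').trans_isLittleO
      (IsLittleO.trans_isTheta ?_ (isTheta_pow_apply_of_sub_pow hμ hm hm').symm)
    have h1 : (fun _ : ℕ => (1 : ℝ)) =o[atTop] fun k : ℕ => (k : ℝ) ^ m := by
      refine ((isLittleO_pow_pow_atTop_of_lt (𝕜 := ℝ) hmpos).comp_tendsto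
        (tendsto_natCast_atTop_atTop (R := ℝ))).congr_left fun k => ?_
      simp
    simpa using (isBigO_refl (fun k : ℕ => ‖μ‖ ^ k) atTop).mul_isLittleO h1
  rw [hbot, Submodule.mem_bot] at hmem
  exact hm hmem

/-- A generalized eigenspace for `κ` is subdominant for `f` if `‖κ‖ < ‖ν‖`, and for `g` if `‖κ‖ >
‖μ‖`; one of these always holds. The two subspaces thus span `E`, and an inclusion would make the
larger one equal to `E`. -/
theorem subdominantSubmodule_not_le_of_norm_lt [Nontrivial E] {f g : Module.End ℂ E}
    (hfg : f * g = 1) (hgf : g * f = 1) {w w' : E} (hw : IsDominant f w) (hw' : IsDominant g w')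
    {μ ν : ℂ} (hμ : f.HasEigenvalue μ) (hν : f.HasEigenvalue ν) (hlt : ‖μ‖ < ‖ν‖) :
    ¬ subdominantSubmodule f w ≤ subdominantSubmodule g w' ∧
      ¬ subdominantSubmodule g w' ≤ subdominantSubmodule f w := by
  have hcover (N : Submodule ℂ E) (h : subdominantSubmodule f w ≤ N)
      (h' : subdominantSubmodule g w' ≤ N) : N = ⊤ := by
    rw [eq_top_iff, ← f.iSup_maxGenEigenspace_eq_top]
    refine iSup_le fun κ v hv => ?_
    rcases lt_or_ge ‖κ‖ ‖ν‖ with hκ | hκ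
    · exact h (mem_subdominantSubmodule_of_norm_lt hfg hgf hw hν hκ hv)
    · exact h' (mem_subdominantSubmodule_inverse_of_norm_lt hfg hgf hw' hμ
        (hlt.trans_le hκ) hv)
  exact ⟨fun h => subdominantSubmodule_ne_top hfg hw' (hcover _ h le_rfl),
    fun h => subdominantSubmodule_ne_top hgf hw (hcover _ le_rfl h)⟩

end FiniteDimensional

end LinearDynamics

/-! ### Comparing the Fubini–Study angle (Euclidean norm) with the sup norm on vectors. -/

section FubiniStudyEstimates

variable {m : ℕ}

theorem norm_le_norm_toLp (x : Fin m → ℂ) :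
    ‖x‖ ≤ ‖(WithLp.toLp 2 x : EuclideanSpace ℂ (Fin m))‖ :=
  (pi_norm_le_iff_of_nonneg (norm_nonneg _)).2 fun i =>
    PiLp.norm_apply_le (WithLp.toLp 2 x : EuclideanSpace ℂ (Fin m)) i

theorem exists_norm_toLp_le (m : ℕ) : ∃ C : ℝ, 0 < C ∧ ∀ x : Fin m → ℂ,
    ‖(WithLp.toLp 2 x : EuclideanSpace ℂ (Fin m))‖ ≤ C * ‖x‖ := by
  let L := LinearMap.toContinuousLinearMap (WithLp.linearEquiv 2 ℂ (Fin m → ℂ)).symm.toLinearMap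
  exact ⟨‖L‖ + 1, by positivity, fun x => (L.le_opNorm x).trans (by gcongr; linarith)⟩

/-- Bound `‖⟨x, y⟩‖` below by its real part, then use polarization and `‖x‖² + ‖y‖² ≥ 2‖x‖‖y‖`. -/
theorem fsAngle_le_arccos {x y : Fin m → ℂ} (hx : x ≠ 0) (hy : y ≠ 0) :
    fsAngle x y ≤ Real.arccos (1 - ‖(WithLp.toLp 2 (x - y) : EuclideanSpace ℂ (Fin m))‖ ^ 2 /
      (2 * (‖(WithLp.toLp 2 x : EuclideanSpace ℂ (Fin m))‖ *
        ‖(WithLp.toLp 2 y : EuclideanSpace ℂ (Fin m))‖))) := by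
  have hx' : 0 < ‖(WithLp.toLp 2 x : EuclideanSpace ℂ (Fin m))‖ := by simpa using hx
  have hy' : 0 < ‖(WithLp.toLp 2 y : EuclideanSpace ℂ (Fin m))‖ := by simpa using hy
  unfold fsAngle
  apply Real.arccos_le_arccos
  rw [WithLp.toLp_sub]
  set a : EuclideanSpace ℂ (Fin m) := WithLp.toLp 2 x
  set b : EuclideanSpace ℂ (Fin m) := WithLp.toLp 2 y
  have h1 := norm_sub_sq (𝕜 := ℂ) a b
  have h2 : RCLike.re (inner ℂ a b) ≤ ‖inner ℂ a b‖ := RCLike.re_le_norm _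
  rw [le_div_iff₀ (by positivity), sub_mul, div_mul_eq_mul_div, mul_div_mul_right _ _ (by positivity)]
  nlinarith [sq_nonneg (‖a‖ - ‖b‖)]

theorem exists_fsAngle_lt_of_norm_sub_sq_le (m : ℕ) {ε : ℝ} (hε : 0 < ε) :
    ∃ δ > 0, ∀ x y : Fin m → ℂ, x ≠ 0 → y ≠ 0 → ‖x - y‖ ^ 2 ≤ δ * (‖x‖ * ‖y‖) →
      fsAngle x y < ε := by
  obtain ⟨C, hC, hCx⟩ := exists_norm_toLp_le m
  have hcont : Tendsto (fun t : ℝ => Real.arccos (1 - t)) (nhds 0) (nhds 0) := by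
    have : Continuous fun t : ℝ => Real.arccos (1 - t) := by fun_prop
    simpa using this.tendsto 0
  obtain ⟨η, hη, hlt⟩ := Metric.eventually_nhds_iff.1 (hcont.eventually_lt_const hε)
  refine ⟨η / C ^ 2, by positivity, fun x y hx hy h => (fsAngle_le_arccos hx hy).trans_lt (hlt ?_)⟩
  have hx' : 0 < ‖x‖ := norm_pos_iff.2 hx
  have hy' : 0 < ‖y‖ := norm_pos_iff.2 hy
  have h1 := norm_le_norm_toLp x
  have h2 := norm_le_norm_toLp y
  have h3 := hCx (x - y)
  set a := ‖(WithLp.toLp 2 x : EuclideanSpace ℂ (Fin m))‖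
  set b := ‖(WithLp.toLp 2 y : EuclideanSpace ℂ (Fin m))‖
  set c := ‖(WithLp.toLp 2 (x - y) : EuclideanSpace ℂ (Fin m))‖ with hc
  have ha : 0 < a := hx'.trans_le h1
  have hb : 0 < b := hy'.trans_le h2
  have hab : ‖x‖ * ‖y‖ ≤ a * b := by gcongr
  have hc0 : 0 ≤ c := norm_nonneg _
  have h4 : c ^ 2 ≤ η * (a * b) := by
    calc c ^ 2 ≤ (C * ‖x - y‖) ^ 2 := by gcongr
      _ = C ^ 2 * ‖x - y‖ ^ 2 := by ring
      _ ≤ C ^ 2 * (η / C ^ 2 * (‖x‖ * ‖y‖)) := by gcongr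
      _ = η * (‖x‖ * ‖y‖) := by field_simp
      _ ≤ η * (a * b) := by gcongr
  rw [Real.dist_eq, sub_zero, abs_of_nonneg (by positivity), div_lt_iff₀ (by positivity)]
  have : 0 < η * (a * b) := by positivity
  linarith

theorem exists_norm_smul_sub_le_of_fsAngle_lt (m : ℕ) {ε : ℝ} (hε : 0 < ε) :
    ∃ δ > 0, ∀ u v : Fin m → ℂ, u ≠ 0 → v ≠ 0 → fsAngle u v < δ →
      ∃ c : ℂ, ‖c • u - v‖ ≤ ε * ‖v‖ := by
  obtain ⟨C, hC, hCx⟩ := exists_norm_toLp_le m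
  refine ⟨ε / C, by positivity, fun u v hu hv h => ?_⟩
  have hu' : 0 < ‖(WithLp.toLp 2 u : EuclideanSpace ℂ (Fin m))‖ := by simpa using hu
  have hv' : 0 < ‖(WithLp.toLp 2 v : EuclideanSpace ℂ (Fin m))‖ := by simpa using hv
  set a : EuclideanSpace ℂ (Fin m) := WithLp.toLp 2 u with ha
  set b : EuclideanSpace ℂ (Fin m) := WithLp.toLp 2 v with hb
  set θ := fsAngle u v with hθ
  have hcos : ‖inner ℂ a b‖ = Real.cos θ * (‖a‖ * ‖b‖) := by
    rw [hθ, fsAngle, Real.cos_arccos, div_mul_cancel₀]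
    · positivity
    · exact (by norm_num : (-1 : ℝ) ≤ 0).trans (by positivity)
    · exact div_le_one_of_le₀ (norm_inner_le_norm _ _) (by positivity)
  have hθ0 : 0 ≤ θ := Real.arccos_nonneg _
  -- This scalar projects `v` orthogonally onto the line of `u`; the error is `sin θ * ‖v‖` in
  -- Euclidean norm.
  refine ⟨inner ℂ a b / (‖a‖ : ℂ) ^ 2, (norm_le_norm_toLp _).trans ?_⟩
  rw [WithLp.toLp_sub, WithLp.toLp_smul, ← ha, ← hb]
  have hsq : ‖(inner ℂ a b / (‖a‖ : ℂ) ^ 2) • a - b‖ ^ 2 = (Real.sin θ * ‖b‖) ^ 2 := by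
    have h1 : RCLike.re (inner ℂ ((inner ℂ a b / (‖a‖ : ℂ) ^ 2) • a) b) =
        ‖inner ℂ a b‖ ^ 2 / ‖a‖ ^ 2 := by
      rw [inner_smul_left, map_div₀, map_pow, Complex.conj_ofReal, div_mul_eq_mul_div,
        Complex.conj_mul', ← Complex.ofReal_pow, ← Complex.ofReal_pow, ← Complex.ofReal_div]
      exact Complex.ofReal_re _
    rw [norm_sub_sq (𝕜 := ℂ), h1, norm_smul, norm_div, norm_pow, Complex.norm_real, norm_norm, hcos,
      mul_pow (Real.sin θ), Real.sin_sq]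
    field_simp
    ring
  have hsin : ‖(inner ℂ a b / (‖a‖ : ℂ) ^ 2) • a - b‖ ≤ θ * ‖b‖ := by
    refine abs_le_of_sq_le_sq' ?_ (by positivity) |>.2
    rw [hsq]
    have h2 : |Real.sin θ| ≤ |θ| := Real.abs_sin_le_abs
    rw [mul_pow, mul_pow]
    gcongr ?_ * _
    exact sq_le_sq.2 h2
  calc _ ≤ θ * ‖b‖ := hsin
    _ ≤ ε / C * (C * ‖v‖) := by gcongr; exact hCx v
    _ = ε * ‖v‖ := by field_simp

/-- When `a` is small against `b`, perturbations of `a` by tiny multiples of `b` already produce two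
directions at angle `π / 4`. Here `a` and `b` will be the images of a subdominant and a dominant
vector. -/
theorem exists_fsAngle_add_smul_eq_pi_div_four {C : ℝ} (hC : ∀ x : Fin m → ℂ,
    ‖(WithLp.toLp 2 x : EuclideanSpace ℂ (Fin m))‖ ≤ C * ‖x‖) (a : Fin m → ℂ) {b : Fin m → ℂ}
    (hb : b ≠ 0) : ∃ c d : ℂ, ‖c‖ ≤ 2 * C * ‖a‖ / ‖b‖ ∧ ‖d‖ ≤ 2 * C * ‖a‖ / ‖b‖ ∧
      (a + c • b ≠ 0 → fsAngle (a + c • b) (a + d • b) = Real.pi / 4) := by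
  have hb' : 0 < ‖(WithLp.toLp 2 b : EuclideanSpace ℂ (Fin m))‖ := by simpa using hb
  have hbn : 0 < ‖b‖ := norm_pos_iff.2 hb
  have hCa := hC a
  have hbb := norm_le_norm_toLp b
  set x : EuclideanSpace ℂ (Fin m) := WithLp.toLp 2 a with hx
  set y : EuclideanSpace ℂ (Fin m) := WithLp.toLp 2 b with hy
  have hyC : (‖y‖ : ℂ) ≠ 0 := by exact_mod_cast hb'.ne'
  have hratio : ‖x‖ / ‖y‖ ≤ C * ‖a‖ / ‖b‖ := by gcongr; exact (norm_nonneg _).trans hCa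
  -- This `c` removes from `a` its component along `b`, leaving `z` orthogonal to `b`.
  set c : ℂ := -(inner ℂ y x / (‖y‖ : ℂ) ^ 2) with hc
  set z := x + c • y with hz
  have horth : inner ℂ y z = 0 := by
    rw [hz, inner_add_right, inner_smul_right, inner_self_eq_norm_sq_to_K, hc]
    simp only [Complex.coe_algebraMap]
    field_simp
    ring
  have horth' : inner ℂ z y = 0 := inner_eq_zero_symm.1 horth
  have hcn : ‖c‖ ≤ ‖x‖ / ‖y‖ := by
    rw [hc, norm_neg, norm_div, norm_pow, Complex.norm_real, norm_norm,
      div_le_div_iff₀ (by positivity) hb']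
    nlinarith [norm_inner_le_norm (𝕜 := ℂ) y x]
  have hzn : ‖z‖ ≤ ‖x‖ := by
    have h1 : x = z + (-c) • y := by rw [hz]; module
    have h2 : ‖x‖ ^ 2 = ‖z‖ ^ 2 + ‖(-c) • y‖ ^ 2 := by
      conv_lhs => rw [h1]
      rw [norm_add_sq (𝕜 := ℂ), inner_smul_right, horth']
      simp
    exact abs_le_of_sq_le_sq' (by nlinarith [sq_nonneg ‖(-c) • y‖]) (norm_nonneg _) |>.2
  -- Now `t • y` is orthogonal to `z` and of equal length, so `z` and `z + t • y` form an angle of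
  -- 45 degrees unless `z = 0`.
  set t : ℝ := ‖z‖ / ‖y‖ with ht
  have ht0 : 0 ≤ t := by positivity
  have htn : t ≤ ‖x‖ / ‖y‖ := by rw [ht]; gcongr
  refine ⟨c, c + t, ?_, ?_, fun hne => ?_⟩
  · have := (norm_nonneg c).trans (hcn.trans hratio)
    calc ‖c‖ ≤ C * ‖a‖ / ‖b‖ := hcn.trans hratio
      _ ≤ C * ‖a‖ / ‖b‖ + C * ‖a‖ / ‖b‖ := by linarith
      _ = _ := by ring
  · calc ‖c + t‖ ≤ ‖c‖ + ‖(t : ℂ)‖ := norm_add_le _ _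
      _ = ‖c‖ + t := by rw [Complex.norm_real, Real.norm_of_nonneg ht0]
      _ ≤ C * ‖a‖ / ‖b‖ + C * ‖a‖ / ‖b‖ := by linarith
      _ = _ := by ring
  · have hz1 : (WithLp.toLp 2 (a + c • b) : EuclideanSpace ℂ (Fin m)) = z := rfl
    have hz2 : (WithLp.toLp 2 (a + (c + t) • b) : EuclideanSpace ℂ (Fin m)) = z + (t : ℂ) • y := by
      rw [hz, WithLp.toLp_add, WithLp.toLp_smul, add_smul, add_assoc]
    have hzpos : 0 < ‖z‖ := by
      rw [← hz1, norm_pos_iff]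
      exact fun h => hne (WithLp.toLp_injective 2 h)
    have hinner : ‖inner ℂ z (z + (t : ℂ) • y)‖ = ‖z‖ ^ 2 := by
      rw [inner_add_right, inner_smul_right, horth', mul_zero, add_zero,
        inner_self_eq_norm_sq_to_K, norm_pow]
      simp
    have hnorm : ‖z + (t : ℂ) • y‖ = √2 * ‖z‖ := by
      have h2 : ‖z + (t : ℂ) • y‖ ^ 2 = (√2 * ‖z‖) ^ 2 := by
        rw [norm_add_sq (𝕜 := ℂ), inner_smul_right, horth', norm_smul, Complex.norm_real,
          Real.norm_of_nonneg ht0, ht, div_mul_cancel₀ _ hb'.ne', mul_pow, Real.sq_sqrt (by norm_num)]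
        simp
        ring
      exact (pow_left_inj₀ (norm_nonneg _) (by positivity) two_ne_zero).1 h2
    unfold fsAngle
    rw [hz1, hz2, hinner, hnorm]
    have : ‖z‖ ^ 2 / (‖z‖ * (√2 * ‖z‖)) = √2 / 2 := by
      have h2 : √2 * √2 = 2 := Real.mul_self_sqrt (by norm_num)
      have h3 : (0 : ℝ) < √2 := by positivity
      rw [div_eq_div_iff (by positivity) (by positivity)]
      linear_combination (-‖z‖ ^ 2) * h2
    rw [this, ← Real.cos_pi_div_four, Real.arccos_cos] <;> linarith [Real.pi_pos]

end FubiniStudyEstimates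

/-! ### Normality implies equicontinuity at a point. -/

section NormalFamilies

variable {X : Type*} [MetricSpace X]

theorem exists_dist_lt_of_mem_equicontinuityRegion {F : Set (X → X)}
    (hF : ∀ g ∈ F, Continuous g) {z : X} (hz : z ∈ equicontinuityRegion F) {ε : ℝ} (hε : 0 < ε) :
    ∃ δ > 0, ∀ g ∈ F, ∀ x, dist x z < δ → dist (g x) (g z) < ε := by
  obtain ⟨U, hU, hzU, hN⟩ := hz
  obtain ⟨r, hr, hball⟩ := Metric.isOpen_iff.1 hU z hzU
  by_contra! hcon
  have hpos (j : ℕ) : 0 < min r (1 / ((j : ℝ) + 1)) := lt_min hr (by positivity)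
  choose g hg x hx hfar using fun j => hcon _ (hpos j)
  obtain ⟨φ, hφ, f, hf⟩ := hN g hg
  have hxz : Tendsto x atTop (nhds z) := by
    rw [tendsto_iff_dist_tendsto_zero]
    exact squeeze_zero (fun _ => dist_nonneg)
      (fun j => (hx j).le.trans (min_le_right _ _)) tendsto_one_div_add_atTop_nhds_zero_nat
  -- A convergent sequence with its limit is compact, so normality can be tested on it; the uniform
  -- limit is continuous there, contradicting the separation of `g j (x j)` from `g j z`.
  have hKU : insert z (Set.range x) ⊆ U := by
    rintro y (rfl | ⟨j, rfl⟩)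
    · exact hzU
    · exact hball ((hx j).trans_le (min_le_left _ _))
  have hunif := hf _ hKU hxz.isCompact_insert_range
  have hcont : ContinuousOn f (insert z (Set.range x)) :=
    hunif.continuousOn (Frequently.of_forall fun j => (hF _ (hg _)).continuousOn)
  have hzK : z ∈ insert z (Set.range x) := Set.mem_insert _ _
  have hxφ : Tendsto (fun j => x (φ j)) atTop (nhdsWithin z (insert z (Set.range x))) :=
    tendsto_nhdsWithin_iff.2 ⟨hxz.comp hφ.tendsto_atTop,
      Eventually.of_forall fun j => Set.mem_insert_of_mem _ ⟨_, rfl⟩⟩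
  have h1 : Tendsto (fun j => g (φ j) (x (φ j))) atTop (nhds (f z)) :=
    hunif.tendsto_comp (hcont z hzK) hxφ
  have h2 : Tendsto (fun j => g (φ j) z) atTop (nhds (f z)) := hunif.tendsto_at hzK
  have h3 := h1.dist h2
  rw [dist_self] at h3
  obtain ⟨j, hj⟩ := (h3.eventually_lt_const hε).exists
  exact absurd hj (not_lt.2 (hfar (φ j)))

end NormalFamilies

/-! ### The equicontinuity set in terms of subdominant subspaces. -/

section ProjectiveAction

variable {n : ℕ}

theorem toLin'_mul_toLin'_inv (A : SL(n + 1, ℂ)) :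
    Matrix.toLin' A.val * Matrix.toLin' (A⁻¹ : SL(n + 1, ℂ)).val = 1 := by
  rw [Module.End.mul_eq_comp, ← Matrix.toLin'_mul, ← Matrix.SpecialLinearGroup.coe_mul, mul_inv_cancel]
  simp [Module.End.one_eq_id]

theorem toLin'_inv_mul_toLin' (A : SL(n + 1, ℂ)) :
    Matrix.toLin' (A⁻¹ : SL(n + 1, ℂ)).val * Matrix.toLin' A.val = 1 := by
  simpa using toLin'_mul_toLin'_inv A⁻¹

theorem toLin'_specialLinearGroup_ne_zero (A : SL(n + 1, ℂ)) {v : Fin (n + 1) → ℂ} (hv : v ≠ 0) :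
    Matrix.toLin' A.val v ≠ 0 :=
  pow_apply_ne_zero (toLin'_inv_mul_toLin' A) 1 hv

theorem psl_smul_mk (A : SL(n + 1, ℂ)) {v : Fin (n + 1) → ℂ} (hv : v ≠ 0) :
    (QuotientGroup.mk A : PSL(n + 1, ℂ)) • Projectivization.mk ℂ v hv =
      Projectivization.mk ℂ (Matrix.toLin' A.val v) (toLin'_specialLinearGroup_ne_zero A hv) :=
  rfl

theorem continuous_psl_smul (γ : PSL(n + 1, ℂ)) :
    Continuous fun p : ℙ ℂ (Fin (n + 1) → ℂ) => γ • p := by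
  obtain ⟨A, rfl⟩ := QuotientGroup.mk_surjective γ
  let L := LinearMap.toContinuousLinearMap (Matrix.toLin' A.val)
  have hL (u : Fin (n + 1) → ℂ) : L u = Matrix.toLin' A.val u := rfl
  refine continuous_iff_continuousAt.2 fun p => Metric.continuousAt_iff.2 fun ε hε => ?_
  induction p using Projectivization.ind with | h v hv => ?_
  have hLv : 0 < ‖L v‖ := norm_pos_iff.2 (toLin'_specialLinearGroup_ne_zero A hv)
  obtain ⟨η, hη, hangle⟩ := exists_fsAngle_lt_of_norm_sub_sq_le (n + 1) hε
  have hlim : Tendsto (fun w => ‖L w - L v‖ ^ 2 - η * (‖L w‖ * ‖L v‖)) (nhds v)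
      (nhds (‖L v - L v‖ ^ 2 - η * (‖L v‖ * ‖L v‖))) :=
    (by fun_prop : Continuous fun w => ‖L w - L v‖ ^ 2 - η * (‖L w‖ * ‖L v‖)).tendsto v
  have hneg : ‖L v - L v‖ ^ 2 - η * (‖L v‖ * ‖L v‖) < 0 := by
    have : 0 < η * (‖L v‖ * ‖L v‖) := by positivity
    simpa using this
  obtain ⟨ρ, hρ, hball⟩ := Metric.eventually_nhds_iff.1
    ((hlim.eventually_lt_const hneg).and (eventually_ne_nhds hv))
  have hv' : 0 < ‖v‖ := norm_pos_iff.2 hv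
  obtain ⟨δ, hδ, hclose⟩ := exists_norm_smul_sub_le_of_fsAngle_lt (n + 1)
    (ε := ρ / (2 * ‖v‖)) (by positivity)
  refine ⟨δ, hδ, fun {q} hq => ?_⟩
  induction q using Projectivization.ind with | h u hu => ?_
  rw [dist_mk_mk] at hq
  obtain ⟨c, hc⟩ := hclose u v hu hv hq
  have hcv : dist (c • u) v < ρ := by
    rw [dist_eq_norm]
    refine hc.trans_lt ?_
    field_simp
    linarith
  obtain ⟨h1, h2⟩ := hball hcv
  have hc0 : c ≠ 0 := by rintro rfl; simp at h2
  rw [psl_smul_mk, psl_smul_mk, dist_mk_mk, ← fsAngle_smul_left _ _ hc0, ← map_smul]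
  exact hangle _ _ (toLin'_specialLinearGroup_ne_zero A h2)
    (toLin'_specialLinearGroup_ne_zero A hv) (sub_neg.1 h1).le

theorem toLin'_pow_specialLinearGroup (A : SL(n + 1, ℂ)) (k : ℕ) :
    Matrix.toLin' (A ^ k).val = Matrix.toLin' A.val ^ k := by
  rw [Matrix.SpecialLinearGroup.coe_pow, Matrix.toLin'_pow]

/-- Near `[v]` there are points `[v + c w]` and `[v + d w]` whose images under a suitable `A ^ k`
are `π / 4` apart, while equicontinuity with `ε = π / 8` would keep them closer. -/
theorem notMem_projEquicontinuitySet_of_mem_subdominantSubmodule (A : SL(n + 1, ℂ))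
    {v w : Fin (n + 1) → ℂ} (hv : v ≠ 0) (hw : w ≠ 0)
    (hvw : v ∈ subdominantSubmodule (Matrix.toLin' A.val) w) :
    Projectivization.mk ℂ v hv ∉
      projEquicontinuitySet (Subgroup.zpowers (QuotientGroup.mk A : PSL(n + 1, ℂ))) := by
  intro hmem
  obtain ⟨C, hC, hCx⟩ := exists_norm_toLp_le (n + 1)
  have hv' : 0 < ‖v‖ := norm_pos_iff.2 hv
  have hw' : 0 < ‖w‖ := norm_pos_iff.2 hw
  have hpi := Real.pi_pos
  obtain ⟨δ, hδ, hequi⟩ := exists_dist_lt_of_mem_equicontinuityRegion (by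
    rintro _ ⟨γ, -, rfl⟩
    exact continuous_psl_smul γ) hmem (ε := Real.pi / 8) (by positivity)
  obtain ⟨η, hη, hangle⟩ := exists_fsAngle_lt_of_norm_sub_sq_le (n + 1) hδ
  -- The bound `1 / 2` keeps `v + e • w` away from zero; `η / 2` makes its angle to `v` less than
  -- `δ`.
  set t : ℝ := min (1 / 2) (min (η / 2) 1) with ht
  have ht0 : 0 < t := by positivity
  have ht1 : t ≤ 1 / 2 := min_le_left _ _
  have ht2 : t ≤ η / 2 := (min_le_right _ _).trans (min_le_left _ _)
  have hnear (e : ℂ) (he : ‖e‖ ≤ t * ‖v‖ / ‖w‖) :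
      ∃ h : v + e • w ≠ 0, dist (Projectivization.mk ℂ _ h) (Projectivization.mk ℂ v hv) < δ := by
    have he' : ‖e • w‖ ≤ t * ‖v‖ := by
      rw [norm_smul]
      exact (le_div_iff₀ hw').1 he
    have hlow : ‖v‖ / 2 ≤ ‖v + e • w‖ := by
      have h1 : ‖v‖ ≤ ‖v + e • w‖ + ‖e • w‖ := by
        simpa using norm_sub_le (v + e • w) (e • w)
      nlinarith
    have hne : v + e • w ≠ 0 := norm_pos_iff.1 (by linarith)
    refine ⟨hne, ?_⟩
    rw [dist_mk_mk]
    refine hangle _ _ hne hv ?_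
    rw [add_sub_cancel_left]
    calc ‖e • w‖ ^ 2 ≤ (t * ‖v‖) ^ 2 := by gcongr
      _ = t * t * ‖v‖ ^ 2 := by ring
      _ ≤ η / 2 * 1 * ‖v‖ ^ 2 := by gcongr; linarith
      _ = η * (‖v‖ / 2 * ‖v‖) := by ring
      _ ≤ η * (‖v + e • w‖ * ‖v‖) := by gcongr
  obtain ⟨k, hk⟩ := ((mem_subdominantSubmodule.1 hvw).bound
    (show 0 < t * ‖v‖ / ‖w‖ / (2 * C) by positivity)).exists
  rw [← toLin'_pow_specialLinearGroup] at hk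
  set B := A ^ k with hB
  have hBw := toLin'_specialLinearGroup_ne_zero B hw
  have hBw' : 0 < ‖Matrix.toLin' B.val w‖ := norm_pos_iff.2 hBw
  obtain ⟨c, d, hc, hd, hcd⟩ := exists_fsAngle_add_smul_eq_pi_div_four hCx
    (Matrix.toLin' B.val v) hBw
  have hsmall : 2 * C * ‖Matrix.toLin' B.val v‖ / ‖Matrix.toLin' B.val w‖ ≤ t * ‖v‖ / ‖w‖ := by
    rw [div_le_iff₀ hBw']
    calc _ ≤ 2 * C * (t * ‖v‖ / ‖w‖ / (2 * C) * ‖Matrix.toLin' B.val w‖) := by gcongr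
      _ = _ := by field_simp
  obtain ⟨hc0, hcδ⟩ := hnear c (hc.trans hsmall)
  obtain ⟨hd0, hdδ⟩ := hnear d (hd.trans hsmall)
  have hγ : (fun p : ℙ ℂ (Fin (n + 1) → ℂ) => (QuotientGroup.mk B : PSL(n + 1, ℂ)) • p) ∈
      {g | ∃ γ ∈ Subgroup.zpowers (QuotientGroup.mk A : PSL(n + 1, ℂ)),
        g = fun p : ℙ ℂ (Fin (n + 1) → ℂ) => γ • p} :=
    ⟨_, ⟨k, by simp [hB]⟩, rfl⟩
  have h1 := hequi _ hγ _ hcδ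
  have h2 := hequi _ hγ _ hdδ
  have h3 := (dist_triangle_right _ _ _).trans_lt (add_lt_add h1 h2)
  have hBc := toLin'_specialLinearGroup_ne_zero B hc0
  simp only [psl_smul_mk, dist_mk_mk, map_add, map_smul] at h3 hBc
  rw [hcd hBc] at h3
  linarith

/-- Dividing `A ^ k` by `‖A ^ k v‖` does not change the projective map and gives operators in a
fixed ball, compact in finite dimension. A limit `T` of a subsequence induces the limit map near
`[v]`. -/
theorem mem_projEquicontinuitySet_of_norm_le (A : SL(n + 1, ℂ)) {v : Fin (n + 1) → ℂ} (hv : v ≠ 0)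
    {C : ℝ} (hC : ∀ (k : ℤ) (u : Fin (n + 1) → ℂ), ‖Matrix.toLin' (A ^ k).val u‖ ≤
      C * ‖u‖ * ‖Matrix.toLin' (A ^ k).val v‖) :
    Projectivization.mk ℂ v hv ∈
      projEquicontinuitySet (Subgroup.zpowers (QuotientGroup.mk A : PSL(n + 1, ℂ))) := by
  classical
  have hv' : 0 < ‖v‖ := norm_pos_iff.2 hv
  have hCpos : 0 < C := by
    have h0 : ‖v‖ ≤ C * ‖v‖ * ‖v‖ := by simpa using hC 0 v
    by_contra! hneg
    nlinarith [mul_pos hv' hv', mul_nonneg (neg_nonneg.2 hneg) (mul_pos hv' hv').le]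
  -- Points of the `δ`-ball have representatives within `1 / (2C)` of `v`, so normalized operators
  -- of norm at most `C`, sending `v` to norm `1`, send them to norm at least `1 / 2`.
  obtain ⟨δ, hδ, hclose⟩ := exists_norm_smul_sub_le_of_fsAngle_lt (n + 1)
    (ε := 1 / (2 * C * ‖v‖)) (by positivity)
  refine ⟨Metric.ball (Projectivization.mk ℂ v hv) δ, Metric.isOpen_ball,
    Metric.mem_ball_self hδ, fun g hg => ?_⟩
  have hlift (j : ℕ) : ∃ k : ℤ, g j = fun p =>
      (QuotientGroup.mk (A ^ k : SL(n + 1, ℂ)) : PSL(n + 1, ℂ)) • p := by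
    obtain ⟨γ, ⟨k, hk⟩, hgj⟩ := hg j
    refine ⟨k, ?_⟩
    rw [hgj, ← hk]
    rfl
  choose κ hκ using hlift
  set B : ℕ → SL(n + 1, ℂ) := fun j => A ^ κ j with hB
  have hBv (j : ℕ) : 0 < ‖Matrix.toLin' (B j).val v‖ :=
    norm_pos_iff.2 (toLin'_specialLinearGroup_ne_zero _ hv)
  let M : ℕ → (Fin (n + 1) → ℂ) →L[ℂ] (Fin (n + 1) → ℂ) := fun j =>
    ((‖Matrix.toLin' (B j).val v‖ : ℂ)⁻¹) •
      LinearMap.toContinuousLinearMap (Matrix.toLin' (B j).val)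
  have hM (j : ℕ) (u : Fin (n + 1) → ℂ) :
      M j u = (‖Matrix.toLin' (B j).val v‖ : ℂ)⁻¹ • Matrix.toLin' (B j).val u := rfl
  have hMC (j : ℕ) : ‖M j‖ ≤ C := by
    refine ContinuousLinearMap.opNorm_le_bound _ hCpos.le fun u => ?_
    rw [hM, norm_smul, norm_inv, Complex.norm_real, norm_norm, inv_mul_le_iff₀ (hBv j), mul_comm]
    exact hC (κ j) u
  have hMv (j : ℕ) : ‖M j v‖ = 1 := by
    rw [hM, norm_smul, norm_inv, Complex.norm_real, norm_norm, inv_mul_cancel₀ (hBv j).ne']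
  have : ProperSpace ((Fin (n + 1) → ℂ) →L[ℂ] (Fin (n + 1) → ℂ)) := FiniteDimensional.proper ℂ _
  obtain ⟨T, -, φ, hφ, hT⟩ := (isCompact_closedBall (0 : (Fin (n + 1) → ℂ) →L[ℂ] _) C).tendsto_subseq
    (x := M) (fun j => by simpa using hMC j)
  let f : ℙ ℂ (Fin (n + 1) → ℂ) → ℙ ℂ (Fin (n + 1) → ℂ) := fun p =>
    if h : T p.rep ≠ 0 then Projectivization.mk ℂ (T p.rep) h else p
  refine ⟨φ, hφ, f, fun K hK _ => ?_⟩
  rw [Metric.tendstoUniformlyOn_iff]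
  intro ε hε
  obtain ⟨η, hη, hangle⟩ := exists_fsAngle_lt_of_norm_sub_sq_le (n + 1) hε
  set R : ℝ := ‖v‖ + 1 / (2 * C) with hR
  have hlim : Tendsto (fun j => (‖T - M (φ j)‖ * R) ^ 2) atTop (nhds 0) := by
    have h1 : Tendsto (fun j => T - M (φ j)) atTop (nhds 0) := by
      simpa using (tendsto_const_nhds (x := T)).sub hT
    simpa using ((h1.norm.mul_const R).pow 2)
  filter_upwards [hlim.eventually_lt_const (show 0 < η * (1 / 2 * (1 / 2)) by positivity)] with j hj
  intro p hp
  have hdist : fsAngle p.rep v < δ := by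
    have := hK hp
    rwa [Metric.mem_ball, ← p.mk_rep, dist_mk_mk] at this
  obtain ⟨c, hc⟩ := hclose p.rep v p.rep_nonzero hv hdist
  have hc' : ‖c • p.rep - v‖ ≤ 1 / (2 * C) := by
    refine hc.trans_eq ?_
    field_simp
  have hMlow (i : ℕ) : 1 / 2 ≤ ‖M i (c • p.rep)‖ := by
    have h1 : ‖M i (c • p.rep - v)‖ ≤ 1 / 2 := by
      calc _ ≤ ‖M i‖ * ‖c • p.rep - v‖ := (M i).le_opNorm _
        _ ≤ C * (1 / (2 * C)) := by gcongr; exact hMC i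
        _ = 1 / 2 := by field_simp
    have h2 : ‖M i v‖ ≤ ‖M i (c • p.rep)‖ + ‖M i (c • p.rep - v)‖ := by
      rw [map_sub]
      simpa using norm_sub_le (M i (c • p.rep)) (M i (c • p.rep) - M i v)
    rw [hMv] at h2
    linarith
  have hTlow : 1 / 2 ≤ ‖T (c • p.rep)‖ := by
    have h1 : Tendsto (fun j => ‖M (φ j) (c • p.rep)‖) atTop (nhds ‖T (c • p.rep)‖) :=
      ((ContinuousLinearMap.apply ℂ (Fin (n + 1) → ℂ) (c • p.rep)).continuous.tendsto T
        |>.comp hT).norm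
    exact ge_of_tendsto' h1 fun i => hMlow _
  have hTne : T (c • p.rep) ≠ 0 := norm_pos_iff.1 (by linarith)
  have hMne : M (φ j) (c • p.rep) ≠ 0 := norm_pos_iff.1 (by linarith [hMlow (φ j)])
  have hc0 : c ≠ 0 := by rintro rfl; simp at hTne
  have hTrep : T p.rep ≠ 0 := fun h => hTne (by rw [map_smul, h, smul_zero])
  have hfp : f p = Projectivization.mk ℂ (T p.rep) hTrep := dif_pos hTrep
  have hgp : g (φ j) p = Projectivization.mk ℂ (Matrix.toLin' (B (φ j)).val p.rep)
      (toLin'_specialLinearGroup_ne_zero _ p.rep_nonzero) := by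
    rw [hκ]
    conv_lhs => rw [← p.mk_rep]
    rfl
  have hscal : (‖Matrix.toLin' (B (φ j)).val v‖ : ℂ)⁻¹ ≠ 0 :=
    inv_ne_zero (by exact_mod_cast (hBv (φ j)).ne')
  rw [hfp, hgp, dist_mk_mk, ← fsAngle_smul_left _ _ hc0, ← fsAngle_smul_right _ _ hc0,
    ← fsAngle_smul_right _ _ hscal, ← map_smul, ← map_smul, ← hM]
  refine hangle _ _ hTne hMne ?_
  have hcR : ‖c • p.rep‖ ≤ R := by
    have : ‖c • p.rep‖ ≤ ‖v‖ + ‖c • p.rep - v‖ := by simpa using norm_add_le v (c • p.rep - v)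
    linarith
  calc ‖T (c • p.rep) - M (φ j) (c • p.rep)‖ ^ 2 = ‖(T - M (φ j)) (c • p.rep)‖ ^ 2 := rfl
    _ ≤ (‖T - M (φ j)‖ * R) ^ 2 := by
      gcongr
      exact ((T - M (φ j)).le_opNorm _).trans (by gcongr)
    _ ≤ η * (1 / 2 * (1 / 2)) := hj.le
    _ ≤ η * (‖T (c • p.rep)‖ * ‖M (φ j) (c • p.rep)‖) := by gcongr; exact hMlow _

/-- By the growth dichotomy a vector that is not subdominant is itself dominant; comparing it with
each basis vector gives a constant uniform in `u`. It serves every `k` because `f ^ k v` never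
vanishes. -/
theorem exists_norm_pow_apply_le {E : Type*} [NormedAddCommGroup E] [NormedSpace ℂ E]
    [FiniteDimensional ℂ E] {f g : Module.End ℂ E} (hfg : f * g = 1) (hgf : g * f = 1) {v w : E}
    (hv : v ≠ 0) (hw : IsDominant f w) (hvw : v ∉ subdominantSubmodule f w) :
    ∃ C : ℝ, 0 ≤ C ∧ ∀ (k : ℕ) (u : E), ‖(f ^ k) u‖ ≤ C * ‖u‖ * ‖(f ^ k) v‖ := by
  have hdom : IsDominant f v := fun u =>
    (hw u).trans ((isLittleO_or_isBigO_pow_apply hfg hgf v w).resolve_left hvw)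
  let b := Module.finBasis ℂ E
  have hbi (i) : ∃ c : ℝ, 0 ≤ c ∧ ∀ k : ℕ, ‖(f ^ k) (b i)‖ ≤ c * ‖(f ^ k) v‖ := by
    obtain ⟨c, hc, h⟩ := bound_of_isBigO_nat_atTop (hdom (b i))
    exact ⟨c, hc.le, fun k => h (pow_apply_ne_zero hgf k hv)⟩
  choose c hc hbound using hbi
  let L (i) := LinearMap.toContinuousLinearMap (b.coord i)
  refine ⟨∑ i, ‖L i‖ * c i, Finset.sum_nonneg fun i _ => mul_nonneg (norm_nonneg _) (hc i),
    fun k u => ?_⟩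
  conv_lhs => rw [← b.sum_repr u]
  rw [map_sum, Finset.sum_mul, Finset.sum_mul]
  refine (norm_sum_le _ _).trans (Finset.sum_le_sum fun i _ => ?_)
  rw [map_smul, norm_smul]
  calc ‖b.repr u i‖ * ‖(f ^ k) (b i)‖ ≤ (‖L i‖ * ‖u‖) * (c i * ‖(f ^ k) v‖) := by
        gcongr
        · exact (L i).le_opNorm u
        · exact hbound i k
    _ = _ := by ring

theorem projEquicontinuitySet_zpowers_eq (A : SL(n + 1, ℂ)) {w w' : Fin (n + 1) → ℂ}
    (hw : IsDominant (Matrix.toLin' A.val) w)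
    (hw' : IsDominant (Matrix.toLin' (A⁻¹ : SL(n + 1, ℂ)).val) w') :
    projEquicontinuitySet (Subgroup.zpowers (QuotientGroup.mk A : PSL(n + 1, ℂ))) =
      (((subdominantSubmodule (Matrix.toLin' A.val) w).projectivization :
          Set (ℙ ℂ (Fin (n + 1) → ℂ))) ∪
        ((subdominantSubmodule (Matrix.toLin' (A⁻¹ : SL(n + 1, ℂ)).val) w').projectivization :
          Set (ℙ ℂ (Fin (n + 1) → ℂ))))ᶜ := by
  have hfg := toLin'_mul_toLin'_inv A
  have hgf := toLin'_inv_mul_toLin' A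
  ext p
  induction p using Projectivization.ind with | h v hv => ?_
  rw [Set.mem_compl_iff, Set.mem_union, SetLike.mem_coe, SetLike.mem_coe,
    Submodule.mk_mem_projectivization_iff, Submodule.mk_mem_projectivization_iff]
  constructor
  · rintro hmem (h | h)
    · exact notMem_projEquicontinuitySet_of_mem_subdominantSubmodule A hv (hw.ne_zero hgf) h hmem
    · refine notMem_projEquicontinuitySet_of_mem_subdominantSubmodule A⁻¹ hv (hw'.ne_zero hfg) h ?_
      rwa [QuotientGroup.mk_inv, Subgroup.zpowers_inv]
  · intro h
    push Not at h
    obtain ⟨C, hC, h1⟩ := exists_norm_pow_apply_le hfg hgf hv hw h.1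
    obtain ⟨C', hC', h2⟩ := exists_norm_pow_apply_le hgf hfg hv hw' h.2
    refine mem_projEquicontinuitySet_of_norm_le A hv (C := C + C') fun k u => ?_
    obtain ⟨j, rfl | rfl⟩ := k.eq_nat_or_neg
    · rw [zpow_natCast, toLin'_pow_specialLinearGroup]
      exact (h1 j u).trans (by gcongr; linarith)
    · rw [zpow_neg, zpow_natCast, ← inv_pow, toLin'_pow_specialLinearGroup]
      exact (h2 j u).trans (by gcongr; linarith)

end ProjectiveAction

/-! ### Diagonalizable matrices and the moduli of eigenvalues. -/

section Diagonalizability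

theorem iSup_eigenspace_eq_top_of_isDiagonalizableMatrix {m : ℕ} {A : Matrix (Fin m) (Fin m) ℂ}
    (h : IsDiagonalizableMatrix A) : ⨆ μ, eigenspace (Matrix.toLin' A) μ = ⊤ := by
  obtain ⟨P, hP⟩ := h
  set D := (P⁻¹ : GL (Fin m) ℂ).val * A * P.val with hD
  have hAP : A * P.val = P.val * D := by
    rw [hD, ← mul_assoc, ← mul_assoc, ← Units.val_mul, mul_inv_cancel, Units.val_one, one_mul]
  refine eq_top_iff.2 fun v _ => ?_
  have hv : v = ∑ i, (P⁻¹ : GL (Fin m) ℂ).val.mulVec v i • P.val.mulVec (Pi.single i 1) := by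
    calc v = P.val.mulVec ((P⁻¹ : GL (Fin m) ℂ).val.mulVec v) := by
          rw [Matrix.mulVec_mulVec, ← Units.val_mul, mul_inv_cancel, Units.val_one,
            Matrix.one_mulVec]
      _ = _ := by
          conv_lhs => rw [pi_eq_sum_univ' ((P⁻¹ : GL (Fin m) ℂ).val.mulVec v)]
          rw [← Matrix.toLin'_apply P.val, map_sum]
          refine Finset.sum_congr rfl fun i _ => ?_
          rw [map_smul, Matrix.toLin'_apply]
  rw [hv]
  refine Submodule.sum_mem _ fun i _ => Submodule.smul_mem _ _ ?_
  refine Submodule.mem_iSup_of_mem (D i i) ?_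
  rw [mem_eigenspace_iff, Matrix.toLin'_apply, Matrix.mulVec_mulVec, hAP, ← Matrix.mulVec_mulVec,
    ← Matrix.mulVec_smul]
  congr 1
  ext j
  by_cases hij : j = i
  · subst hij; simp
  · simp [hij, hP hij]

theorem isDiagonalizableMatrix_of_iSup_eigenspace_eq_top {m : ℕ} {A : Matrix (Fin m) (Fin m) ℂ}
    (h : ⨆ μ, eigenspace (Matrix.toLin' A) μ = ⊤) : IsDiagonalizableMatrix A := by
  classical
  have hspan : ⊤ ≤ Submodule.span ℂ {v | ∃ μ : ℂ, Matrix.toLin' A v = μ • v} := by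
    rw [← h]
    exact iSup_le fun μ v hv => Submodule.subset_span ⟨μ, mem_eigenspace_iff.1 hv⟩
  let b₀ := Module.Basis.ofSpan hspan
  let e := b₀.indexEquiv (Pi.basisFun ℂ (Fin m))
  let b := b₀.reindex e
  have hb (i : Fin m) : ∃ μ : ℂ, Matrix.toLin' A (b i) = μ • b i := by
    refine Module.Basis.ofSpan_subset hspan ⟨e.symm i, ?_⟩
    rw [Module.Basis.reindex_apply]
  choose d hd using hb
  let s := Pi.basisFun ℂ (Fin m)
  refine ⟨⟨s.toMatrix b, b.toMatrix s, s.toMatrix_mul_toMatrix_flip b,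
    b.toMatrix_mul_toMatrix_flip s⟩, ?_⟩
  have hA : A = LinearMap.toMatrix s s (Matrix.toLin' A) := by
    rw [LinearMap.toMatrix_eq_toMatrix', LinearMap.toMatrix'_toLin']
  have key : b.toMatrix s * A * s.toMatrix b = LinearMap.toMatrix b b (Matrix.toLin' A) := by
    conv_lhs => rw [hA]
    exact basis_toMatrix_mul_linearMap_toMatrix_mul_basis_toMatrix b s b s _
  change (b.toMatrix s * A * s.toMatrix b).IsDiag
  rw [key]
  intro i j hij
  rw [LinearMap.toMatrix_apply, hd]
  simp [hij.symm]

/-- If all eigenvalues had the modulus of `μ`, the determinant, their product, would make a positive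
power of `‖μ‖` equal to `1`. -/
theorem exists_eigenvalue_norm_ne {m : ℕ} {A : Matrix (Fin m) (Fin m) ℂ} (hdet : A.det = 1)
    {μ : ℂ} (hμ : HasEigenvalue (Matrix.toLin' A) μ) (hne : ‖μ‖ ≠ 1) :
    ∃ ν, HasEigenvalue (Matrix.toLin' A) ν ∧ ‖ν‖ ≠ ‖μ‖ := by
  by_contra! hall
  have hroots : ∀ ν ∈ A.charpoly.roots, ‖ν‖ = ‖μ‖ := by
    intro ν hν
    refine hall ν ((hasEigenvalue_iff_isRoot_charpoly _ _).2 ?_)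
    rw [Matrix.charpoly_toLin']
    exact Polynomial.isRoot_of_mem_roots hν
  have hmem : μ ∈ A.charpoly.roots := by
    rw [Polynomial.mem_roots A.charpoly_monic.ne_zero, ← Matrix.charpoly_toLin']
    exact (hasEigenvalue_iff_isRoot_charpoly _ _).1 hμ
  have h1 := congrArg norm (Matrix.det_eq_prod_roots_charpoly A)
  rw [hdet, norm_one] at h1
  have h2 : ‖A.charpoly.roots.prod‖ = (A.charpoly.roots.map norm).prod :=
    map_multiset_prod (normHom : ℂ →*₀ ℝ) _
  rw [h2, Multiset.map_congr rfl hroots, Multiset.map_const', Multiset.prod_replicate] at h1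
  refine hne ((pow_eq_one_iff_of_nonneg (norm_nonneg _) ?_).1 h1.symm)
  exact (Multiset.card_pos_iff_exists_mem.2 ⟨μ, hmem⟩).ne'

end Diagonalizability

/-! ### The possible shapes of the equicontinuity set exclude each other. -/

section ProjectiveSubspaces

variable {n : ℕ}

theorem projectivization_subset_iff {W W' : Submodule ℂ (Fin (n + 1) → ℂ)} :
    (W.projectivization : Set (ℙ ℂ (Fin (n + 1) → ℂ))) ⊆ W'.projectivization ↔ W ≤ W' := by
  rw [SetLike.coe_subset_coe, OrderIso.le_iff_le]

theorem projectivization_ne_univ {W : Submodule ℂ (Fin (n + 1) → ℂ)} (hW : W ≠ ⊤) :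
    (W.projectivization : Set (ℙ ℂ (Fin (n + 1) → ℂ))) ≠ Set.univ := by
  intro h
  refine hW (eq_top_iff.2 (projectivization_subset_iff.1 ?_))
  rw [h]
  exact Set.subset_univ _

theorem projectivization_nonempty {W : Submodule ℂ (Fin (n + 1) → ℂ)} (hW : W ≠ ⊥) :
    (W.projectivization : Set (ℙ ℂ (Fin (n + 1) → ℂ))).Nonempty := by
  obtain ⟨v, hv, hv0⟩ := W.ne_bot_iff.1 hW
  exact ⟨Projectivization.mk ℂ v hv0, (Submodule.mk_mem_projectivization_iff W hv0).2 hv⟩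

theorem projectivization_bot :
    ((⊥ : Submodule ℂ (Fin (n + 1) → ℂ)).projectivization : Set (ℙ ℂ (Fin (n + 1) → ℂ))) = ∅ := by
  simp

theorem le_or_le_of_projectivization_union {W₁ W₂ W : Submodule ℂ (Fin (n + 1) → ℂ)}
    (h : (W₁.projectivization ∪ W₂.projectivization : Set (ℙ ℂ (Fin (n + 1) → ℂ))) =
      W.projectivization) : W₁ ≤ W₂ ∨ W₂ ≤ W₁ := by
  have h₁ : W₁ ≤ W := projectivization_subset_iff.1 (h ▸ Set.subset_union_left)
  have h₂ : W₂ ≤ W := projectivization_subset_iff.1 (h ▸ Set.subset_union_right)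
  by_contra! hcon
  obtain ⟨x, hx₁, hx₂⟩ := SetLike.not_le_iff_exists.1 hcon.1
  obtain ⟨y, hy₂, hy₁⟩ := SetLike.not_le_iff_exists.1 hcon.2
  -- For `x` in `W₁` only and `y` in `W₂` only, `x + y` lies in `W` but in neither `W₁` nor `W₂`.
  have hxy : x + y ≠ 0 := fun h0 => hx₂ (by
    rw [eq_neg_of_add_eq_zero_left h0]; exact W₂.neg_mem hy₂)
  have hmem : Projectivization.mk ℂ (x + y) hxy ∈
      (W.projectivization : Set (ℙ ℂ (Fin (n + 1) → ℂ))) :=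
    (Submodule.mk_mem_projectivization_iff W hxy).2 (W.add_mem (h₁ hx₁) (h₂ hy₂))
  rw [← h] at hmem
  rcases hmem with hm | hm
  · exact hy₁ ((W₁.add_mem_iff_right hx₁).1 ((Submodule.mk_mem_projectivization_iff W₁ hxy).1 hm))
  · exact hx₂ ((W₂.add_mem_iff_left hy₂).1 ((Submodule.mk_mem_projectivization_iff W₂ hxy).1 hm))

/-- `S` is the complement of two proper projective subspaces, neither containing the other. -/
def IsComplOfTwoSubspaces (S : Set (ℙ ℂ (Fin (n + 1) → ℂ))) : Prop :=
  ∃ L₁ L₂ : Set (ℙ ℂ (Fin (n + 1) → ℂ)), IsProjectiveSubspace L₁ ∧ IsProjectiveSubspace L₂ ∧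
    L₁ ≠ Set.univ ∧ L₂ ≠ Set.univ ∧ ¬ L₁ ⊆ L₂ ∧ ¬ L₂ ⊆ L₁ ∧ S = (L₁ ∪ L₂)ᶜ

/-- `S` is the complement of a projective subspace. -/
def IsComplOfSubspace (S : Set (ℙ ℂ (Fin (n + 1) → ℂ))) : Prop :=
  ∃ L₁ : Set (ℙ ℂ (Fin (n + 1) → ℂ)), IsProjectiveSubspace L₁ ∧ S = L₁ᶜ

theorem IsComplOfTwoSubspaces.ne_univ {S : Set (ℙ ℂ (Fin (n + 1) → ℂ))}
    (h : IsComplOfTwoSubspaces S) : S ≠ Set.univ := by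
  obtain ⟨L₁, L₂, ⟨⟨p, hp⟩, -⟩, -, -, -, -, -, rfl⟩ := h
  exact fun h => (h ▸ Set.mem_univ p : p ∈ (L₁ ∪ L₂)ᶜ) (Or.inl hp)

theorem IsComplOfSubspace.ne_univ {S : Set (ℙ ℂ (Fin (n + 1) → ℂ))}
    (h : IsComplOfSubspace S) : S ≠ Set.univ := by
  obtain ⟨L₁, ⟨⟨p, hp⟩, -⟩, rfl⟩ := h
  exact fun h => (h ▸ Set.mem_univ p : p ∈ L₁ᶜ) hp

theorem IsComplOfTwoSubspaces.not_isComplOfSubspace {S : Set (ℙ ℂ (Fin (n + 1) → ℂ))}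
    (h : IsComplOfTwoSubspaces S) : ¬ IsComplOfSubspace S := by
  obtain ⟨L₁, L₂, ⟨-, W₁, rfl⟩, ⟨-, W₂, rfl⟩, -, -, h₁, h₂, rfl⟩ := h
  rintro ⟨L, ⟨-, W, rfl⟩, hL⟩
  rw [projectivization_subset_iff] at h₁ h₂
  exact (le_or_le_of_projectivization_union (compl_injective hL)).elim h₁ h₂

end ProjectiveSubspaces

/-! ### The three types of transformation. -/

section Classification

variable {n : ℕ}

theorem projEquicontinuitySet_eq_univ_of_isDiagonalizableMatrix (A : SL(n + 1, ℂ))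
    (hd : IsDiagonalizableMatrix A.val) (hu : HasUnitaryEigenvalues A.val) :
    projEquicontinuitySet (Subgroup.zpowers (QuotientGroup.mk A : PSL(n + 1, ℂ))) = Set.univ := by
  have hfg := toLin'_mul_toLin'_inv A
  have hgf := toLin'_inv_mul_toLin' A
  obtain ⟨w, hw⟩ := exists_isDominant hfg hgf
  obtain ⟨w', hw'⟩ := exists_isDominant hgf hfg
  rw [projEquicontinuitySet_zpowers_eq A hw hw',
    ← subdominantSubmodule_eq_of_unit_eigenvalues hfg hgf hu hw hw',
    subdominantSubmodule_eq_bot_of_iSup_eigenspace hfg hgf hu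
      (iSup_eigenspace_eq_top_of_isDiagonalizableMatrix hd), projectivization_bot]
  simp

theorem isComplOfTwoSubspaces_projEquicontinuitySet (A : SL(n + 1, ℂ))
    (h : ∃ μ : ℂ, Module.End.HasEigenvalue (Matrix.toLin' A.val) μ ∧ ‖μ‖ ≠ 1) :
    IsComplOfTwoSubspaces
      (projEquicontinuitySet (Subgroup.zpowers (QuotientGroup.mk A : PSL(n + 1, ℂ)))) := by
  have hfg := toLin'_mul_toLin'_inv A
  have hgf := toLin'_inv_mul_toLin' A
  obtain ⟨w, hw⟩ := exists_isDominant hfg hgf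
  obtain ⟨w', hw'⟩ := exists_isDominant hgf hfg
  obtain ⟨μ, hμ, hne⟩ := h
  obtain ⟨ν, hν, hνμ⟩ := exists_eigenvalue_norm_ne A.det_coe hμ hne
  obtain ⟨h₁, h₂⟩ : ¬ subdominantSubmodule (Matrix.toLin' A.val) w ≤
        subdominantSubmodule (Matrix.toLin' (A⁻¹ : SL(n + 1, ℂ)).val) w' ∧
      ¬ subdominantSubmodule (Matrix.toLin' (A⁻¹ : SL(n + 1, ℂ)).val) w' ≤
        subdominantSubmodule (Matrix.toLin' A.val) w := by
    rcases lt_or_gt_of_ne hνμ with hlt | hlt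
    · exact subdominantSubmodule_not_le_of_norm_lt hfg hgf hw hw' hν hμ hlt
    · exact subdominantSubmodule_not_le_of_norm_lt hfg hgf hw hw' hμ hν hlt
  exact ⟨_, _, ⟨projectivization_nonempty fun hb => h₁ (hb.trans_le bot_le), _, rfl⟩,
    ⟨projectivization_nonempty fun hb => h₂ (hb.trans_le bot_le), _, rfl⟩,
    projectivization_ne_univ (subdominantSubmodule_ne_top hgf hw),
    projectivization_ne_univ (subdominantSubmodule_ne_top hfg hw'),
    mt projectivization_subset_iff.1 h₁, mt projectivization_subset_iff.1 h₂,
    projEquicontinuitySet_zpowers_eq A hw hw'⟩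

theorem projEquicontinuitySet_of_not_isDiagonalizableMatrix (A : SL(n + 1, ℂ))
    (hu : HasUnitaryEigenvalues A.val) (hd : ¬ IsDiagonalizableMatrix A.val) :
    IsComplOfSubspace
        (projEquicontinuitySet (Subgroup.zpowers (QuotientGroup.mk A : PSL(n + 1, ℂ)))) ∧
      (projEquicontinuitySet
        (Subgroup.zpowers (QuotientGroup.mk A : PSL(n + 1, ℂ)))).Nonempty := by
  have hfg := toLin'_mul_toLin'_inv A
  have hgf := toLin'_inv_mul_toLin' A
  obtain ⟨w, hw⟩ := exists_isDominant hfg hgf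
  obtain ⟨w', hw'⟩ := exists_isDominant hgf hfg
  rw [projEquicontinuitySet_zpowers_eq A hw hw',
    ← subdominantSubmodule_eq_of_unit_eigenvalues hfg hgf hu hw hw', Set.union_self]
  refine ⟨⟨_, ⟨projectivization_nonempty fun hb => hd ?_, _, rfl⟩, rfl⟩,
    Set.nonempty_compl.2 (projectivization_ne_univ (subdominantSubmodule_ne_top hgf hw))⟩
  exact isDiagonalizableMatrix_of_iSup_eigenspace_eq_top
    (iSup_eigenspace_eq_top_of_subdominantSubmodule_eq_bot hgf hw hb)

end Classification

theorem theorem2 (n : ℕ) (γ : PSL(n + 1, ℂ)) :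
    (IsEllipticPSL γ ↔ projEquicontinuitySet (Subgroup.zpowers γ) = Set.univ) ∧
    (IsLoxodromicPSL γ ↔
      ∃ L₁ L₂ : Set (ℙ ℂ (Fin (n + 1) → ℂ)),
        IsProjectiveSubspace L₁ ∧ IsProjectiveSubspace L₂ ∧
        L₁ ≠ Set.univ ∧ L₂ ≠ Set.univ ∧ ¬ L₁ ⊆ L₂ ∧ ¬ L₂ ⊆ L₁ ∧
        projEquicontinuitySet (Subgroup.zpowers γ) = (L₁ ∪ L₂)ᶜ) ∧
    (IsParabolicPSL γ ↔
      ∃ L₁ : Set (ℙ ℂ (Fin (n + 1) → ℂ)),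
        IsProjectiveSubspace L₁ ∧ projEquicontinuitySet (Subgroup.zpowers γ) = L₁ᶜ) ∧
    (IsParabolicPSL γ → (projEquicontinuitySet (Subgroup.zpowers γ)).Nonempty) := by
  obtain ⟨A₀, hA₀⟩ := QuotientGroup.mk_surjective γ
  set S := projEquicontinuitySet (Subgroup.zpowers γ) with hS
  have hell (A : SL(n + 1, ℂ)) (hA : (QuotientGroup.mk A : PSL(n + 1, ℂ)) = γ)
      (h : IsDiagonalizableMatrix A.val ∧ HasUnitaryEigenvalues A.val) : S = Set.univ := by
    rw [hS, ← hA]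
    exact projEquicontinuitySet_eq_univ_of_isDiagonalizableMatrix A h.1 h.2
  have hlox (A : SL(n + 1, ℂ)) (hA : (QuotientGroup.mk A : PSL(n + 1, ℂ)) = γ)
      (h : ∃ μ : ℂ, Module.End.HasEigenvalue (Matrix.toLin' A.val) μ ∧ ‖μ‖ ≠ 1) :
      IsComplOfTwoSubspaces S := by
    rw [hS, ← hA]
    exact isComplOfTwoSubspaces_projEquicontinuitySet A h
  have hpar (A : SL(n + 1, ℂ)) (hA : (QuotientGroup.mk A : PSL(n + 1, ℂ)) = γ)
      (h : HasUnitaryEigenvalues A.val ∧ ¬ IsDiagonalizableMatrix A.val) :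
      IsComplOfSubspace S ∧ S.Nonempty := by
    rw [hS, ← hA]
    exact projEquicontinuitySet_of_not_isDiagonalizableMatrix A h.1 h.2
  -- Every lift falls under one of the three cases, and the shape of `S` rules out two of them;
  -- hence the converses hold for all lifts.
  have htri (A : SL(n + 1, ℂ)) : (IsDiagonalizableMatrix A.val ∧ HasUnitaryEigenvalues A.val) ∨
      (∃ μ : ℂ, Module.End.HasEigenvalue (Matrix.toLin' A.val) μ ∧ ‖μ‖ ≠ 1) ∨
      (HasUnitaryEigenvalues A.val ∧ ¬ IsDiagonalizableMatrix A.val) := by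
    by_cases hu : HasUnitaryEigenvalues A.val
    · by_cases hd : IsDiagonalizableMatrix A.val
      · exact Or.inl ⟨hd, hu⟩
      · exact Or.inr (Or.inr ⟨hu, hd⟩)
    · unfold HasUnitaryEigenvalues at hu
      push Not at hu
      exact Or.inr (Or.inl hu)
  refine ⟨⟨fun h => hell A₀ hA₀ (h A₀ hA₀), fun h A hA => ?_⟩,
    ⟨fun h => hlox A₀ hA₀ (h A₀ hA₀), fun h A hA => ?_⟩,
    ⟨fun h => (hpar A₀ hA₀ (h A₀ hA₀)).1, fun h A hA => ?_⟩,
    fun h => (hpar A₀ hA₀ (h A₀ hA₀)).2⟩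
  · rcases htri A with h' | h' | h'
    · exact h'
    · exact absurd h (hlox A hA h').ne_univ
    · exact absurd h (hpar A hA h').1.ne_univ
  · have h : IsComplOfTwoSubspaces S := h
    rcases htri A with h' | h' | h'
    · exact absurd (hell A hA h') h.ne_univ
    · exact h'
    · exact absurd (hpar A hA h').1 h.not_isComplOfSubspace
  · have h : IsComplOfSubspace S := h
    rcases htri A with h' | h' | h'
    · exact absurd (hell A hA h') h.ne_univ
    · exact absurd h (hlox A hA h').not_isComplOfSubspace
    · exact h'
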